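/- **Theorem 1.1.** Let $n\in\mathbb N$, let $P_1\in\mathbb C^{n\times n}$ be Hermitian and invertible, $P_0\in\mathbb C^{n\times n}$, $\tilde W_B\in\mathbb C^{n\times 2n}$, and let $\mathcal H:(0,1)\to\mathbb C^{n\times n}$ have positive definite Hermitian values a.e., with $\mathcal H,\mathcal H^{-1}\in L^\infty(0,1;\mathbb C^{n\times n})$. On $X_2=L^2(0,1;\mathbb C^n)$ with its standard inner product $\langle\cdot,\cdot\rangle$, let $$Ax=P_1\frac{dx}{d\zeta}+P_0x,\qquad D(A)=\Big\{x\in W^{1,2}(0,1;\mathbb C^n)\ \Big|\ \tilde W_B\begin{bmatrix}x(1)\\x(0)\end{bmatrix}=0\Big\},$$ and let $A\mathcal H$ have domain $D(A\mathcal H)=\{x\in X_2\mid \mathcal Hx\in D(A)\}$. Put $$W_B=\tilde W_B\begin{bmatrix}P_1&-P_1\\ I&I\end{bmatrix}^{-1},\qquad \Sigma=\begin{bmatrix}0&I\\ I&0\end{bmatrix},\qquad \operatorname{Re}P_0=\tfrac12(P_0+P_0^*),$$ where $\le 0$ and $\ge0$ for Hermitian matrices mean negative and positive semidefinite. 1.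 The following statements are equivalent: - (a) $A\mathcal H$ generates a contraction semigroup (a $C_0$-semigroup of contractions) on $X_2$ equipped with the energy inner product $\langle\cdot,\mathcal H\cdot\rangle$; - (b) $\operatorname{Re}\langle Ax,x\rangle\le0$ for every $x\in D(A)$; - (c) $\operatorname{Re}P_0\le0$ and $u^*P_1u-y^*P_1y\le0$ for every $\begin{bmatrix}u\\y\end{bmatrix}\in\ker\tilde W_B$; - (d) $\operatorname{Re}P_0\le0$, $W_B\Sigma W_B^*\ge0$ and $\operatorname{rank}\tilde W_B=n$. 2. The following statements are equivalent: - (a) $A\mathcal H$ generates a unitary $C_0$-group on $X_2$ equipped with the energy inner product $\langle\cdot,\mathcal H\cdot\rangle$; - (b) $\operatorname{Re}\langle Ax,x\rangle=0$ for every $x\in D(A)$; - (c) $\operatorname{Re}P_0=0$ and $u^*P_1u-y^*P_1y=0$ for every $\begin{bmatrix}u\\y\end{bmatrix}\in\ker\tilde W_B$; - (d) $\operatorname{Re}P_0=0$, $W_B\Sigma W_B^*=0$ and $\operatorname{rank}\tilde W_B=n$. -/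

import Mathlib

open MeasureTheory Filter Topology Set
open scoped NNReal ENNReal Matrix ComplexOrder ContDiff

/-! ### Strongly continuous semigroups and groups -/

/-- A `C₀`-semigroup of bounded linear operators on a complex normed space. -/
structure C0Semigroup (E : Type*) [NormedAddCommGroup E] [NormedSpace ℂ E] where
  toFun : ℝ≥0 → E →L[ℂ] E
  map_zero' : toFun 0 = ContinuousLinearMap.id ℂ E
  map_add' : ∀ s t, toFun (s + t) = (toFun s).comp (toFun t)
  strongly_continuous' : ∀ x, Tendsto (fun t => toFun t x) (𝓝[>] 0) (𝓝 x)

/-- A `C₀`-group of bounded linear operators on a complex normed space. -/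
structure C0Group (E : Type*) [NormedAddCommGroup E] [NormedSpace ℂ E] where
  toFun : ℝ → E →L[ℂ] E
  map_zero' : toFun 0 = ContinuousLinearMap.id ℂ E
  map_add' : ∀ s t, toFun (s + t) = (toFun s).comp (toFun t)
  strongly_continuous' : ∀ x, Tendsto (fun t => toFun t x) (𝓝 0) (𝓝 x)

/-- `A` is the infinitesimal generator of the semigroup `T`: the pair `(x, y)` lies in the graph
of `A` exactly when `(T h x - x) / h → y` as `h ↓ 0`. -/
def C0Semigroup.IsGenerator {E : Type*} [NormedAddCommGroup E] [NormedSpace ℂ E]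
    (T : C0Semigroup E) (A : E →ₗ.[ℂ] E) : Prop :=
  ∀ x y : E, (x, y) ∈ A.graph ↔
    Tendsto (fun h : ℝ≥0 => (((h : ℝ) : ℂ)⁻¹) • (T.toFun h x - x)) (𝓝[>] 0) (𝓝 y)

/-- `A` is the infinitesimal generator of the group `U` (two-sided limit of `(U h x - x) / h`). -/
def C0Group.IsGenerator {E : Type*} [NormedAddCommGroup E] [NormedSpace ℂ E]
    (U : C0Group E) (A : E →ₗ.[ℂ] E) : Prop :=
  ∀ x y : E, (x, y) ∈ A.graph ↔
    Tendsto (fun h : ℝ => ((h : ℂ)⁻¹) • (U.toFun h x - x)) (𝓝[≠] 0) (𝓝 y)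

/-- `A` generates a contraction semigroup: a `C₀`-semigroup with `‖T t‖ ≤ 1` for all `t ≥ 0`. -/
def GeneratesContractionSemigroup {E : Type*} [NormedAddCommGroup E] [NormedSpace ℂ E]
    (A : E →ₗ.[ℂ] E) : Prop :=
  ∃ T : C0Semigroup E, (∀ t, ‖T.toFun t‖ ≤ 1) ∧ T.IsGenerator A

/-- `A` generates a unitary `C₀`-group: every `U t` is surjective and preserves the inner
product. -/
def GeneratesUnitaryGroup {E : Type*} [NormedAddCommGroup E] [InnerProductSpace ℂ E]
    (A : E →ₗ.[ℂ] E) : Prop :=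
  ∃ U : C0Group E,
    (∀ t, Function.Surjective (U.toFun t) ∧
      ∀ x y, inner ℂ (U.toFun t x) (U.toFun t y) = inner ℂ x y) ∧
    U.IsGenerator A

/-! ### The space `L²(0,1;ℂⁿ)` and weak derivatives -/

/-- Lebesgue measure on the open unit interval. -/
noncomputable abbrev unitIntervalMeasure : Measure ℝ := volume.restrict (Ioo (0 : ℝ) 1)

/-- The space `L²(0,1;ℂⁿ)` with its usual inner product. -/
abbrev StateSpace (n : ℕ) : Type := Lp (EuclideanSpace ℂ (Fin n)) 2 unitIntervalMeasure

/-- `g` is the weak derivative of `x` on `(0,1)`: `∫ φ' x = - ∫ φ g` for every test function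
`φ ∈ C_c^∞(0,1)`. -/
def HasWeakDeriv {n : ℕ} (x g : StateSpace n) : Prop :=
  ∀ φ : ℝ → ℝ, ContDiff ℝ ∞ φ → HasCompactSupport φ → tsupport φ ⊆ Ioo (0 : ℝ) 1 →
    ∫ ζ in Ioo (0 : ℝ) 1, deriv φ ζ • x ζ = -∫ ζ in Ioo (0 : ℝ) 1, φ ζ • g ζ

theorem integrable_test_smul {n : ℕ} (x : StateSpace n) {φ : ℝ → ℝ} (hφ : Continuous φ)
    (hc : HasCompactSupport φ) :
    Integrable (fun ζ => φ ζ • x ζ) unitIntervalMeasure := by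
  have hx : Integrable x unitIntervalMeasure :=
    (Lp.memLp x).integrable (by norm_num)
  obtain ⟨C, hC⟩ := hc.exists_bound_of_continuous hφ
  exact hx.bdd_smul C hφ.aestronglyMeasurable (ae_of_all _ hC)

theorem HasWeakDeriv.add {n : ℕ} {x g y k : StateSpace n} (hx : HasWeakDeriv x g)
    (hy : HasWeakDeriv y k) : HasWeakDeriv (x + y) (g + k) := by
  intro φ h1 h2 h3
  have d1 : Continuous (deriv φ) := h1.continuous_deriv (by simp)
  have e1 : ∫ ζ in Ioo (0 : ℝ) 1, deriv φ ζ • (x + y : StateSpace n) ζ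
      = ∫ ζ in Ioo (0 : ℝ) 1, (deriv φ ζ • x ζ + deriv φ ζ • y ζ) := by
    refine integral_congr_ae ?_
    filter_upwards [Lp.coeFn_add x y] with ζ h
    rw [h, Pi.add_apply, smul_add]
  have e2 : ∫ ζ in Ioo (0 : ℝ) 1, φ ζ • (g + k : StateSpace n) ζ
      = ∫ ζ in Ioo (0 : ℝ) 1, (φ ζ • g ζ + φ ζ • k ζ) := by
    refine integral_congr_ae ?_
    filter_upwards [Lp.coeFn_add g k] with ζ h
    rw [h, Pi.add_apply, smul_add]
  rw [e1, e2, integral_add (integrable_test_smul x d1 h2.deriv)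
    (integrable_test_smul y d1 h2.deriv), integral_add (integrable_test_smul g h1.continuous h2)
    (integrable_test_smul k h1.continuous h2), hx φ h1 h2 h3, hy φ h1 h2 h3, neg_add]

theorem HasWeakDeriv.smul {n : ℕ} {x g : StateSpace n} (c : ℂ) (hx : HasWeakDeriv x g) :
    HasWeakDeriv (c • x) (c • g) := by
  intro φ h1 h2 h3
  have e1 : ∫ ζ in Ioo (0 : ℝ) 1, deriv φ ζ • (c • x : StateSpace n) ζ
      = ∫ ζ in Ioo (0 : ℝ) 1, c • (deriv φ ζ • x ζ) := by
    refine integral_congr_ae ?_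
    filter_upwards [Lp.coeFn_smul c x] with ζ h
    rw [h, Pi.smul_apply, smul_comm]
  have e2 : ∫ ζ in Ioo (0 : ℝ) 1, φ ζ • (c • g : StateSpace n) ζ
      = ∫ ζ in Ioo (0 : ℝ) 1, c • (φ ζ • g ζ) := by
    refine integral_congr_ae ?_
    filter_upwards [Lp.coeFn_smul c g] with ζ h
    rw [h, Pi.smul_apply, smul_comm]
  rw [e1, e2, integral_smul, integral_smul, hx φ h1 h2 h3, smul_neg]

theorem HasWeakDeriv.zero {n : ℕ} : HasWeakDeriv (0 : StateSpace n) 0 := by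
  have h0 : ∀ ψ : ℝ → ℝ, ∫ ζ in Ioo (0 : ℝ) 1, ψ ζ • (0 : StateSpace n) ζ = 0 := by
    intro ψ
    rw [← integral_zero ℝ (EuclideanSpace ℂ (Fin n)) (μ := unitIntervalMeasure)]
    refine integral_congr_ae ?_
    filter_upwards [Lp.coeFn_zero (EuclideanSpace ℂ (Fin n)) 2 unitIntervalMeasure] with ζ h
    rw [h, Pi.zero_apply, smul_zero]
  intro φ _ _ _
  rw [h0, h0, neg_zero]

theorem HasWeakDeriv.eq_zero {n : ℕ} {g : StateSpace n}
    (h : HasWeakDeriv (0 : StateSpace n) g) : g = 0 := by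
  have hg : Integrable g unitIntervalMeasure := (Lp.memLp g).integrable (by norm_num)
  have key := isOpen_Ioo.ae_eq_zero_of_integral_contDiff_smul_eq_zero (U := Ioo (0 : ℝ) 1)
    (f := g) (μ := volume) (IntegrableOn.locallyIntegrableOn hg) (by
      intro φ h1 h2 h3
      have h4 := h φ h1 h2 h3
      have h5 : ∫ ζ in Ioo (0 : ℝ) 1, deriv φ ζ • (0 : StateSpace n) ζ = 0 := by
        rw [← integral_zero ℝ (EuclideanSpace ℂ (Fin n)) (μ := unitIntervalMeasure)]
        refine integral_congr_ae ?_
        filter_upwards [Lp.coeFn_zero (EuclideanSpace ℂ (Fin n)) 2 unitIntervalMeasure] with ζ h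
        rw [h, Pi.zero_apply, smul_zero]
      rw [h5] at h4
      have h6 := neg_eq_zero.mp h4.symm
      rw [← h6, setIntegral_eq_integral_of_forall_compl_eq_zero]
      intro ζ hζ
      have : φ ζ = 0 := by
        by_contra hne
        exact hζ (h3 (subset_tsupport φ hne))
      simp [this])
  rw [Lp.eq_zero_iff_ae_eq_zero]
  exact (ae_restrict_iff' measurableSet_Ioo).mpr key

/-- The graph `{(x, g) | g is the weak derivative of x}` in `L² × L²`. -/
def weakDerivGraph (n : ℕ) : Submodule ℂ (StateSpace n × StateSpace n) where
  carrier := {p | HasWeakDeriv p.1 p.2}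
  add_mem' := fun ha hb => HasWeakDeriv.add ha hb
  zero_mem' := HasWeakDeriv.zero
  smul_mem' := fun c _ hx => HasWeakDeriv.smul c hx

theorem weakDerivGraph_single_valued (n : ℕ) (p : StateSpace n × StateSpace n)
    (hp : p ∈ weakDerivGraph n) (h0 : p.1 = 0) : p.2 = 0 := by
  have h : HasWeakDeriv p.1 p.2 := hp
  rw [h0] at h
  exact h.eq_zero

/-- The operator `d/dζ` on `L²(0,1;ℂⁿ)`, with domain the Sobolev space `W^{1,2}(0,1;ℂⁿ)`. -/
noncomputable def weakDeriv (n : ℕ) : StateSpace n →ₗ.[ℂ] StateSpace n :=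
  (weakDerivGraph n).toLinearPMap

theorem hasWeakDeriv_weakDeriv {n : ℕ} (x : (weakDeriv n).domain) :
    HasWeakDeriv (x : StateSpace n) (weakDeriv n x) :=
  Submodule.mem_graph_toLinearPMap (weakDerivGraph_single_valued n) x

/-! ### The operator `A = P₁ d/dζ + P₀` with boundary conditions -/

/-- Multiplication of an `L²` function by a constant matrix. -/
noncomputable def constMul {n : ℕ} (M : Matrix (Fin n) (Fin n) ℂ) :
    StateSpace n →L[ℂ] StateSpace n :=
  (Matrix.toEuclideanCLM (n := Fin n) (𝕜 := ℂ) M).compLpL 2 unitIntervalMeasure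

/-- The domain of `A`: those `x ∈ W^{1,2}(0,1;ℂⁿ)` whose continuous representative `u` on `[0,1]`
satisfies `W̃ [u(1); u(0)] = 0`. -/
def bdryDomain {n : ℕ} (W : Matrix (Fin n) (Fin n ⊕ Fin n) ℂ) : Submodule ℂ (StateSpace n) where
  carrier := {x | x ∈ (weakDeriv n).domain ∧
    ∃ u : ℝ → EuclideanSpace ℂ (Fin n), ContinuousOn u (Icc 0 1) ∧
      (x =ᵐ[unitIntervalMeasure] u) ∧ W *ᵥ Sum.elim (u 1).ofLp (u 0).ofLp = 0}
  add_mem' := by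
    rintro x y ⟨hx, u, hu, hxu, hW⟩ ⟨hy, v, hv, hyv, hW'⟩
    refine ⟨Submodule.add_mem _ hx hy, u + v, hu.add hv, (Lp.coeFn_add x y).trans (hxu.add hyv), ?_⟩
    have : Sum.elim ((u + v) 1).ofLp ((u + v) 0).ofLp
        = Sum.elim (u 1).ofLp (u 0).ofLp + Sum.elim (v 1).ofLp (v 0).ofLp := by
      ext i; cases i <;> simp
    rw [this, Matrix.mulVec_add, hW, hW', add_zero]
  zero_mem' := by
    refine ⟨Submodule.zero_mem _, 0, continuousOn_const, Lp.coeFn_zero _ _ _, ?_⟩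
    have : Sum.elim ((0 : ℝ → EuclideanSpace ℂ (Fin n)) 1).ofLp
        ((0 : ℝ → EuclideanSpace ℂ (Fin n)) 0).ofLp = 0 := by
      ext i; cases i <;> simp
    rw [this, Matrix.mulVec_zero]
  smul_mem' := by
    rintro c x ⟨hx, u, hu, hxu, hW⟩
    refine ⟨Submodule.smul_mem _ c hx, c • u, hu.const_smul c,
      (Lp.coeFn_smul c x).trans (hxu.const_smul c), ?_⟩
    have : Sum.elim ((c • u) 1).ofLp ((c • u) 0).ofLp
        = c • Sum.elim (u 1).ofLp (u 0).ofLp := by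
      ext i; cases i <;> simp
    rw [this, Matrix.mulVec_smul, hW, smul_zero]

theorem bdryDomain_le {n : ℕ} (W : Matrix (Fin n) (Fin n ⊕ Fin n) ℂ) :
    bdryDomain W ≤ (weakDeriv n).domain := fun _ hx => hx.1

/-- The operator `A x = P₁ x' + P₀ x` on `L²(0,1;ℂⁿ)` with domain `bdryDomain W`. -/
noncomputable def portOperator {n : ℕ} (P₁ P₀ : Matrix (Fin n) (Fin n) ℂ)
    (W : Matrix (Fin n) (Fin n ⊕ Fin n) ℂ) : StateSpace n →ₗ.[ℂ] StateSpace n where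
  domain := bdryDomain W
  toFun := (constMul P₁).toLinearMap ∘ₗ (weakDeriv n).toFun ∘ₗ
      Submodule.inclusion (bdryDomain_le W) +
    (constMul P₀).toLinearMap ∘ₗ (bdryDomain W).subtype

/-! ### The Hamiltonian density and the energy space -/

/-- A Hamiltonian density: a function with positive definite Hermitian matrix values a.e. on
`(0,1)` such that `𝓗` and `𝓗⁻¹` are in `L^∞(0,1;ℂ^{n×n})`. -/
structure HamiltonianDensity (n : ℕ) where
  toFun : ℝ → Matrix (Fin n) (Fin n) ℂ
  posDef : ∀ᵐ ζ ∂unitIntervalMeasure, (toFun ζ).PosDef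
  memLp_top : ∀ i j, MemLp (fun ζ => toFun ζ i j) ∞ unitIntervalMeasure
  memLp_top_inv : ∀ i j, MemLp (fun ζ => (toFun ζ)⁻¹ i j) ∞ unitIntervalMeasure

namespace HamiltonianDensity

variable {n : ℕ} (H : HamiltonianDensity n)

theorem memLp_mul (x : StateSpace n) :
    MemLp (fun ζ => Matrix.toEuclideanCLM (n := Fin n) (𝕜 := ℂ) (H.toFun ζ) (x ζ)) 2
      unitIntervalMeasure := by
  refine MemLp.of_eval_piLp fun i => ?_
  have : (fun ζ => Matrix.toEuclideanCLM (n := Fin n) (𝕜 := ℂ) (H.toFun ζ) (x ζ) i)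
      = fun ζ => ∑ j, H.toFun ζ i j * x ζ j := by
    ext ζ
    simp [Matrix.ofLp_toEuclideanCLM, Matrix.mulVec, dotProduct]
  rw [this]
  refine memLp_finsetSum _ fun j _ => ?_
  exact ((Lp.memLp x).eval_piLp j).mul (H.memLp_top i j)

/-- The multiplication operator `x ↦ 𝓗 x` on `L²(0,1;ℂⁿ)`. -/
noncomputable def mul : StateSpace n →ₗ[ℂ] StateSpace n where
  toFun x := (H.memLp_mul x).toLp
  map_add' x y := by
    ext1
    filter_upwards [(H.memLp_mul (x + y)).coeFn_toLp, (H.memLp_mul x).coeFn_toLp,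
      (H.memLp_mul y).coeFn_toLp, Lp.coeFn_add x y,
      Lp.coeFn_add (H.memLp_mul x).toLp (H.memLp_mul y).toLp] with ζ h1 h2 h3 h4 h5
    rw [h1, h5, Pi.add_apply, h2, h3, h4, Pi.add_apply, map_add]
  map_smul' c x := by
    ext1
    filter_upwards [(H.memLp_mul (c • x)).coeFn_toLp, (H.memLp_mul x).coeFn_toLp,
      Lp.coeFn_smul c x, Lp.coeFn_smul c (H.memLp_mul x).toLp] with ζ h1 h2 h3 h4
    simp only [RingHom.id_apply]
    rw [h1, h4, Pi.smul_apply, h2, h3, Pi.smul_apply, map_smul]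

theorem coeFn_mul (x : StateSpace n) :
    H.mul x =ᵐ[unitIntervalMeasure]
      fun ζ => Matrix.toEuclideanCLM (n := Fin n) (𝕜 := ℂ) (H.toFun ζ) (x ζ) :=
  (H.memLp_mul x).coeFn_toLp

end HamiltonianDensity

/-- The energy space: the vector space `L²(0,1;ℂⁿ)`, to be equipped with the inner product
`⟨x, y⟩ = ⟨x, 𝓗 y⟩_{L²}`. -/
def EnergySpace {n : ℕ} (_H : HamiltonianDensity n) : Type := StateSpace n

namespace EnergySpace

variable {n : ℕ} (H : HamiltonianDensity n)

theorem inner_eq_dotProduct (M : Matrix (Fin n) (Fin n) ℂ) (a b : EuclideanSpace ℂ (Fin n)) :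
    inner ℂ a (Matrix.toEuclideanCLM (n := Fin n) (𝕜 := ℂ) M b) = star a.ofLp ⬝ᵥ (M *ᵥ b.ofLp) := by
  rw [EuclideanSpace.inner_eq_star_dotProduct, Matrix.ofLp_toEuclideanCLM, dotProduct_comm]

noncomputable instance : AddCommGroup (EnergySpace H) :=
  inferInstanceAs (AddCommGroup (StateSpace n))

noncomputable instance : Module ℂ (EnergySpace H) :=
  inferInstanceAs (Module ℂ (StateSpace n))

/-- The identity map between the energy space and `L²(0,1;ℂⁿ)`. -/
noncomputable def equiv : EnergySpace H ≃ₗ[ℂ] StateSpace n := LinearEquiv.refl ℂ (StateSpace n)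

theorem inner_mul_eq_integral (x y : StateSpace n) :
    inner ℂ x (H.mul y) = ∫ ζ in Ioo (0 : ℝ) 1, star (x ζ).ofLp ⬝ᵥ (H.toFun ζ *ᵥ (y ζ).ofLp) := by
  rw [L2.inner_def]
  refine integral_congr_ae ?_
  filter_upwards [H.coeFn_mul y] with ζ h
  rw [h, inner_eq_dotProduct]

theorem integrable_energy (x y : StateSpace n) :
    Integrable (fun ζ => star (x ζ).ofLp ⬝ᵥ (H.toFun ζ *ᵥ (y ζ).ofLp)) unitIntervalMeasure := by
  refine (L2.integrable_inner (𝕜 := ℂ) x (H.mul y)).congr ?_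
  filter_upwards [H.coeFn_mul y] with ζ h
  rw [h, inner_eq_dotProduct]

noncomputable instance : InnerProductSpace.Core ℂ (EnergySpace H) where
  inner x y := inner ℂ (equiv H x) (H.mul (equiv H y))
  conj_inner_symm x y := by
    rw [inner_mul_eq_integral, inner_mul_eq_integral, ← integral_conj]
    refine integral_congr_ae ?_
    filter_upwards [H.posDef] with ζ h
    rw [Matrix.star_dotProduct, Matrix.star_mulVec, h.isHermitian.eq, ← Matrix.dotProduct_mulVec]
    exact star_star _
  re_inner_nonneg x := by
    rw [inner_mul_eq_integral, ← integral_re (integrable_energy H _ _)]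
    refine integral_nonneg_of_ae ?_
    filter_upwards [H.posDef] with ζ h
    exact (Complex.nonneg_iff.mp (h.posSemidef.dotProduct_mulVec_nonneg _)).1
  add_left x y z := by
    rw [map_add, inner_add_left]
  smul_left x y r := by
    rw [map_smul, inner_smul_left]
  definite x hx := by
    rw [inner_mul_eq_integral] at hx
    have h1 := congrArg RCLike.re hx
    rw [← integral_re (integrable_energy H _ _), map_zero, integral_eq_zero_iff_of_nonneg_ae] at h1
    · refine (Lp.eq_zero_iff_ae_eq_zero (f := equiv H x)).mpr ?_
      filter_upwards [H.posDef, h1] with ζ h h2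
      by_contra hne
      have hne' : (equiv H x ζ).ofLp ≠ 0 := fun h0 => hne (by ext i; exact congrFun h0 i)
      exact (Complex.pos_iff.mp (h.dotProduct_mulVec_pos hne')).1.ne' h2
    · filter_upwards [H.posDef] with ζ h
      exact (Complex.nonneg_iff.mp (h.posSemidef.dotProduct_mulVec_nonneg _)).1
    · exact (integrable_energy H _ _).re

noncomputable instance : NormedAddCommGroup (EnergySpace H) :=
  InnerProductSpace.Core.toNormedAddCommGroup (𝕜 := ℂ)

noncomputable instance : InnerProductSpace ℂ (EnergySpace H) :=
  InnerProductSpace.ofCore _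

/-- The energy inner product is `⟨x, 𝓗 y⟩` in `L²(0,1;ℂⁿ)`. -/
theorem inner_def (x y : EnergySpace H) :
    inner ℂ x y = inner ℂ (equiv H x) (H.mul (equiv H y)) := rfl

end EnergySpace

/-- The operator `A𝓗` on the energy space, with domain `{x | 𝓗 x ∈ D(A)}`. -/
noncomputable def compHamiltonian {n : ℕ} (A : StateSpace n →ₗ.[ℂ] StateSpace n)
    (H : HamiltonianDensity n) : EnergySpace H →ₗ.[ℂ] EnergySpace H where
  domain := A.domain.comap (H.mul ∘ₗ (EnergySpace.equiv H).toLinearMap)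
  toFun := (EnergySpace.equiv H).symm.toLinearMap ∘ₗ A.toFun ∘ₗ
    (H.mul ∘ₗ (EnergySpace.equiv H).toLinearMap).restrict (fun _ hx => hx)

/-! ### Matrices -/

/-- The Hermitian part `Re M = (M + M*) / 2` of a square matrix. -/
noncomputable def hermitianPart {n : ℕ} (M : Matrix (Fin n) (Fin n) ℂ) :
    Matrix (Fin n) (Fin n) ℂ := (1 / 2 : ℂ) • (M + Mᴴ)

/-- `W_B = W̃_B [P₁, -P₁; I, I]⁻¹`. -/
noncomputable def transformedBdryMatrix {n : ℕ} (P₁ : Matrix (Fin n) (Fin n) ℂ)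
    (W : Matrix (Fin n) (Fin n ⊕ Fin n) ℂ) : Matrix (Fin n) (Fin n ⊕ Fin n) ℂ :=
  W * (Matrix.fromBlocks P₁ (-P₁) 1 1)⁻¹

/-- `Σ = [0, I; I, 0]`. -/
def swapMatrix (n : ℕ) : Matrix (Fin n ⊕ Fin n) (Fin n ⊕ Fin n) ℂ :=
  Matrix.fromBlocks 0 1 1 0

/-! ### Exponentials of bounded dissipative operators -/

section BoundedDissipative

variable {E : Type*} [NormedAddCommGroup E] [InnerProductSpace ℂ E] [CompleteSpace E]

open NormedSpace

/-! The energy inner product is chosen so that `𝓗` cancels: with `z = 𝓗x`, the number `⟨A𝓗x, x⟩` in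
the energy space is `⟨Az, z⟩` in `L²`, and `z` runs through all of `D(A)`. So `A𝓗` is dissipative
exactly when `A` is. A generator of contractions is dissipative by differentiation at `0`; the
converse is Lumer–Phillips (Stone for groups), proved through Yosida approximations, and it needs `μ
- A𝓗` to be onto.

Surjectivity comes without a rank hypothesis. For `A`, `portOperator_exists_smul_sub_eq` solves an
ODE; the boundary condition is a square linear system for `u(0)`, and dissipativity makes it
injective. For `A𝓗` one must invert `μ𝓗⁻¹ - A`, a coercive operator minus a dissipative one, which
is done by a Neumann series in `LinearPMap.exists_sub_eq_of_coercive`.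

Dissipativity becomes a matrix condition because `2 Re⟨P₁x', x⟩` is the boundary form `u*P₁u -
y*P₁y` with `u = x(1)`, `y = x(0)` (`two_mul_re_inner_constMul_deriv`). Test functions vanishing at
the ends isolate `Re P₀`; functions concentrating at the ends isolate the boundary form.

Finally, `[P₁, -P₁; I, I]` carries twice the boundary form to the form of `Σ`, whose signature is
`(n, n)`. A nonpositive subspace has dimension at most `n`, while the kernel of an `n × 2n` matrix
has dimension at least `n`; so a nonpositive kernel is maximal and its `Σ`-orthogonal complement,
the range of `ΣW_B*`, is nonnegative. This is `swapForm_nonpos_on_ker_iff`. The unitary case is the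
contraction case for both `(P₁, P₀)` and `(-P₁, -P₀)`. -/

theorem re_inner_real_smul_nonpos {E : Type*} [NormedAddCommGroup E] [InnerProductSpace ℂ E]
    {x y : E} {s : ℝ} (hs : 0 ≤ s) (h : (inner ℂ x y).re ≤ 0) :
    (inner ℂ (s • x) y).re ≤ 0 := by
  rw [← Complex.coe_smul, inner_smul_left]
  simpa using mul_nonpos_of_nonneg_of_nonpos hs h

theorem HasDerivAt.clm_complex_apply {E : Type*} [NormedAddCommGroup E] [NormedSpace ℂ E]
    {F : ℝ → E →L[ℂ] E} {F' : E →L[ℂ] E} {s : ℝ} (h : HasDerivAt F F' s) (x : E) :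
    HasDerivAt (fun s => F s x) (F' x) s :=
  ((ContinuousLinearMap.apply ℂ E x).restrictScalars ℝ).hasFDerivAt.comp_hasDerivAt s h

theorem hasDerivAt_exp_smul_apply (B : E →L[ℂ] E) (x : E) (s : ℝ) :
    HasDerivAt (fun s : ℝ => exp (s • B) x) (B (exp (s • B) x)) s := by
  exact (hasDerivAt_exp_smul_const' (𝕂 := ℝ) B s).clm_complex_apply x

/-- The derivative of `‖e^{sB}x‖²` is `2 Re⟨B e^{sB}x, e^{sB}x⟩ ≤ 0`; compare `s = 0` with `s = 1`.
-/
theorem norm_exp_apply_le {B : E →L[ℂ] E} (hB : ∀ x, (inner ℂ (B x) x).re ≤ 0) (x : E) :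
    ‖exp B x‖ ≤ ‖x‖ := by
  let _ : InnerProductSpace ℝ E := InnerProductSpace.rclikeToReal ℂ E
  have hd : ∀ s : ℝ, HasDerivAt (fun s : ℝ => ‖exp (s • B) x‖ ^ 2)
      (2 * inner ℝ (exp (s • B) x) (B (exp (s • B) x))) s :=
    fun s => (hasDerivAt_exp_smul_apply B x s).norm_sq
  have hanti : Antitone (fun s : ℝ => ‖exp (s • B) x‖ ^ 2) := by
    refine antitone_of_deriv_nonpos (fun s => (hd s).differentiableAt) fun s => ?_
    rw [(hd s).deriv, real_inner_comm]
    have : inner ℝ (B (exp (s • B) x)) (exp (s • B) x) ≤ 0 := hB _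
    linarith
  have h := hanti zero_le_one
  simp only [one_smul, zero_smul, exp_zero, one_apply_eq_self] at h
  exact (sq_le_sq₀ (norm_nonneg _) (norm_nonneg _)).mp h

/-- Interpolate by `s ↦ e^{sB} e^{(1-s)C} x`. Commutativity turns its derivative into `e^{sB}
e^{(1-s)C} (B - C)x`, and both exponentials are contractions. -/
theorem norm_exp_apply_sub_exp_apply_le {B C : E →L[ℂ] E} (hBC : Commute B C)
    (hB : ∀ x, (inner ℂ (B x) x).re ≤ 0) (hC : ∀ x, (inner ℂ (C x) x).re ≤ 0) (x : E) :
    ‖exp B x - exp C x‖ ≤ ‖B x - C x‖ := by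
  have hd : ∀ s : ℝ, HasDerivAt (fun s : ℝ => (exp (s • B) * exp ((1 - s) • C)) x)
      ((exp (s • B) * exp ((1 - s) • C)) (B x - C x)) s := by
    intro s
    have h1 := hasDerivAt_exp_smul_const (𝕂 := ℝ) B s
    have h2 : HasDerivAt (fun s : ℝ => exp ((1 - s) • C)) (-(C * exp ((1 - s) • C))) s := by
      have := (hasDerivAt_exp_smul_const' (𝕂 := ℝ) C (1 - s)).scomp s
        ((hasDerivAt_const s (1 : ℝ)).sub (hasDerivAt_id s))
      simpa [Function.comp_def] using this
    have h3 := (h1.mul h2).clm_complex_apply x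
    have c1 : Commute B (exp ((1 - s) • C)) := (hBC.smul_right _).exp_right
    have c2 : Commute C (exp ((1 - s) • C)) := ((Commute.refl C).smul_right _).exp_right
    have : exp (s • B) * B * exp ((1 - s) • C) + exp (s • B) * -(C * exp ((1 - s) • C))
        = exp (s • B) * exp ((1 - s) • C) * (B - C) := by
      rw [mul_neg, c2.eq, mul_assoc, c1.eq, mul_sub, mul_assoc, mul_assoc]
      abel
    rw [this] at h3
    exact h3
  have hbound : ∀ s ∈ Ico (0 : ℝ) 1,
      ‖(exp (s • B) * exp ((1 - s) • C)) (B x - C x)‖ ≤ ‖B x - C x‖ := by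
    intro s hs
    refine (norm_exp_apply_le (fun y => ?_) _).trans (norm_exp_apply_le (fun y => ?_) _)
    · exact re_inner_real_smul_nonpos hs.1 (hB y)
    · exact re_inner_real_smul_nonpos (sub_nonneg.mpr hs.2.le) (hC y)
  have h := norm_image_sub_le_of_norm_deriv_le_segment_01'
    (fun s _ => (hd s).hasDerivWithinAt) hbound
  simpa using h

/-- A Taylor remainder bound free of `‖B‖`, so that it survives an unbounded limit of the `B`. Since
`B(Bx)` need not stay bounded there, `Bx` is replaced by a nearby `y`, later taken in the domain of
the limit operator. -/
theorem norm_exp_apply_sub_sub_le {B : E →L[ℂ] E} (hB : ∀ x, (inner ℂ (B x) x).re ≤ 0)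
    (x y : E) : ‖exp B x - x - B x‖ ≤ 2 * ‖B x - y‖ + ‖B y‖ := by
  have hd : ∀ s : ℝ, HasDerivAt (fun s : ℝ => exp (s • B) x - s • B x)
      (exp (s • B) (B x) - B x) s := by
    intro s
    have h1 := (hasDerivAt_exp_smul_const (𝕂 := ℝ) B s).clm_complex_apply x
    have h2 := (hasDerivAt_id s).smul_const (B x)
    simpa using h1.fun_sub h2
  have hbound : ∀ s ∈ Ico (0 : ℝ) 1,
      ‖exp (s • B) (B x) - B x‖ ≤ 2 * ‖B x - y‖ + ‖B y‖ := by
    intro s hs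
    have hsB : ∀ z, (inner ℂ ((s • B) z) z).re ≤ 0 :=
      fun z => re_inner_real_smul_nonpos hs.1 (hB z)
    have h1 : ‖exp (s • B) (B x - y)‖ ≤ ‖B x - y‖ := norm_exp_apply_le hsB _
    have h2 : ‖exp (s • B) y - y‖ ≤ ‖B y‖ := by
      have := norm_exp_apply_sub_exp_apply_le (Commute.zero_right (s • B)) hsB (by simp) y
      simp only [exp_zero, one_apply_eq_self, zero_apply,
        sub_zero, smul_apply, norm_smul, Real.norm_eq_abs,
        abs_of_nonneg hs.1] at this
      exact this.trans (mul_le_of_le_one_left (norm_nonneg _) hs.2.le)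
    have h3 : exp (s • B) (B x) - B x
        = exp (s • B) (B x - y) - (B x - y) + (exp (s • B) y - y) := by
      rw [map_sub]; abel
    rw [h3]
    refine (norm_add_le _ _).trans ?_
    have := norm_sub_le (exp (s • B) (B x - y)) (B x - y)
    linarith
  have h := norm_image_sub_le_of_norm_deriv_le_segment_01'
    (fun s _ => (hd s).hasDerivWithinAt) hbound
  have e : exp B x - x - B x = exp ((1 : ℝ) • B) x - (1 : ℝ) • B x
      - (exp ((0 : ℝ) • B) x - (0 : ℝ) • B x) := by
    simp; abel
  rw [e]
  exact h

end BoundedDissipative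

/-! ### Limits of exponentials of commuting approximants -/

section Limit

variable {E : Type*} [NormedAddCommGroup E] [InnerProductSpace ℂ E] [CompleteSpace E]

open NormedSpace

/-- The exponentials of commuting bounded dissipative operators `r • B k`, with `B k → A` strongly
on the dense domain of `A`, converge strongly to a contraction. -/
theorem exists_tendsto_exp_smul {A : E →ₗ.[ℂ] E} (hdense : Dense (A.domain : Set E))
    {B : ℕ → E →L[ℂ] E} (hcomm : ∀ j k, Commute (B j) (B k))
    (hlim : ∀ x : A.domain, Tendsto (fun k => B k x) atTop (𝓝 (A x)))
    {r : ℝ} (hB : ∀ k x, (inner ℂ ((r • B k) x) x).re ≤ 0) :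
    ∃ T : E →L[ℂ] E, ‖T‖ ≤ 1 ∧ (∀ x, Tendsto (fun k => exp (r • B k) x) atTop (𝓝 (T x))) ∧
      ∀ x y : A.domain, ‖T x - x - r • A x‖ ≤ |r| * (2 * ‖A x - y‖ + |r| * ‖A y‖) := by
  have hcauchy : ∀ x : E, CauchySeq (fun k => exp (r • B k) x) := by
    intro x
    rw [Metric.cauchySeq_iff']
    intro ε hε
    obtain ⟨d, hd, hxd⟩ := Metric.mem_closure_iff.mp (hdense x) (ε / 3) (by positivity)
    have hc : CauchySeq (fun k => (r • B k) d) :=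
      ((hlim ⟨d, hd⟩).const_smul r).cauchySeq
    obtain ⟨N, hN⟩ := Metric.cauchySeq_iff'.mp hc (ε / 3) (by positivity)
    refine ⟨N, fun k hk => ?_⟩
    have h1 : dist (exp (r • B k) x) (exp (r • B k) d) < ε / 3 := by
      rw [dist_eq_norm, ← map_sub]
      exact (norm_exp_apply_le (hB k) _).trans_lt (by rwa [← dist_eq_norm])
    have h2 : dist (exp (r • B N) d) (exp (r • B N) x) < ε / 3 := by
      rw [dist_comm, dist_eq_norm, ← map_sub]
      exact (norm_exp_apply_le (hB N) _).trans_lt (by rwa [← dist_eq_norm])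
    have h3 : dist (exp (r • B k) d) (exp (r • B N) d) < ε / 3 := by
      refine lt_of_le_of_lt ?_ (hN k hk)
      rw [dist_eq_norm, dist_eq_norm]
      exact norm_exp_apply_sub_exp_apply_le
        (((hcomm k N).smul_left r).smul_right r) (hB k) (hB N) d
    have := dist_triangle4 (exp (r • B k) x) (exp (r • B k) d) (exp (r • B N) d)
      (exp (r • B N) x)
    linarith
  choose f hf using fun x => cauchySeq_tendsto_of_complete (hcauchy x)
  let T : E →L[ℂ] E := continuousLinearMapOfTendsto (fun k => exp (r • B k))
    (tendsto_pi_nhds.mpr hf)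
  have hT : ∀ x, Tendsto (fun k => exp (r • B k) x) atTop (𝓝 (T x)) := hf
  refine ⟨T, ?_, hT, fun x y => ?_⟩
  · refine T.opNorm_le_bound zero_le_one fun x => ?_
    rw [one_mul]
    exact le_of_tendsto' (hT x).norm fun k => norm_exp_apply_le (hB k) x
  · have h1 : Tendsto (fun k => ‖exp (r • B k) x - x - r • B k x‖) atTop
        (𝓝 ‖T x - x - r • A x‖) :=
      (((hT x).sub_const _).sub ((hlim x).const_smul r)).norm
    have h2 : Tendsto (fun k => |r| * (2 * ‖B k x - y‖ + |r| * ‖B k y‖)) atTop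
        (𝓝 (|r| * (2 * ‖A x - y‖ + |r| * ‖A y‖))) :=
      ((((hlim x).sub_const _).norm.const_mul 2).add ((hlim y).norm.const_mul |r|)).const_mul |r|
    refine le_of_tendsto_of_tendsto' h1 h2 fun k => ?_
    -- The auxiliary vector is scaled by `r` too, so that a factor `|r|` can be taken out of the
    -- whole bound.
    have := norm_exp_apply_sub_sub_le (hB k) (x : E) (r • (y : E))
    simp only [smul_apply, ← smul_sub, norm_smul, Real.norm_eq_abs,
      (B k).map_smul_of_tower] at this
    linarith

/-- Strong continuity and differentiability at `0` of a family of contractions from a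
second-order estimate on a dense domain. -/
theorem tendsto_apply_of_estimate {E : Type*} [NormedAddCommGroup E] [NormedSpace ℂ E]
    {A : E →ₗ.[ℂ] E} (hdense : Dense (A.domain : Set E)) {ι : Type*} {l : Filter ι} {r : ι → ℝ}
    (hr : Tendsto r l (𝓝 0)) {T : ι → E →L[ℂ] E} (hT : ∀ i, ‖T i‖ ≤ 1)
    (hest : ∀ i, ∀ x y : A.domain,
      ‖T i x - x - r i • A x‖ ≤ |r i| * (2 * ‖A x - y‖ + |r i| * ‖A y‖)) (x : E) :
    Tendsto (fun i => T i x) l (𝓝 x) := by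
  rw [Metric.tendsto_nhds]
  intro ε hε
  obtain ⟨d, hd, hxd⟩ := Metric.mem_closure_iff.mp (hdense x) (ε / 3) (by positivity)
  have h0 : Tendsto (fun i => |r i| * (3 * ‖A ⟨d, hd⟩‖)) l (𝓝 0) := by
    simpa using hr.abs.mul_const (3 * ‖A ⟨d, hd⟩‖)
  filter_upwards [h0.eventually_lt_const (show (0 : ℝ) < ε / 3 by positivity)] with i hi
  have h1 : ‖T i d - d‖ ≤ |r i| * (3 * ‖A ⟨d, hd⟩‖) := by
    -- Taking `y = 0` gives `2|r|‖Ad‖`; the term `r • Ad` adds the third multiple.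
    have := hest i ⟨d, hd⟩ 0
    simp only [ZeroMemClass.coe_zero, sub_zero, norm_zero, mul_zero, add_zero,
      LinearPMap.map_zero] at this
    have h2 := norm_add_le (T i d - d - r i • A ⟨d, hd⟩) (r i • A ⟨d, hd⟩)
    rw [sub_add_cancel, norm_smul, Real.norm_eq_abs] at h2
    linarith
  have h2 : ‖T i (x - d)‖ ≤ ‖x - d‖ := (T i).le_of_opNorm_le_of_le (hT i) le_rfl |>.trans (by simp)
  have h3 : T i x - x = T i (x - d) + (T i d - d) - (x - d) := by rw [map_sub]; abel
  rw [dist_eq_norm] at hxd ⊢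
  rw [h3]
  have h4 := norm_sub_le (T i (x - d) + (T i d - d)) (x - d)
  have h5 := norm_add_le (T i (x - d)) (T i d - d)
  linarith

/-- Dividing the estimate by `|r|` leaves `2‖Ax - d‖ + |r|‖Ad‖`: pick `d` in the domain close to
`Ax`, then let `r → 0`. -/
theorem tendsto_inv_smul_of_estimate {E : Type*} [NormedAddCommGroup E] [NormedSpace ℂ E]
    {A : E →ₗ.[ℂ] E} (hdense : Dense (A.domain : Set E)) {ι : Type*} {l : Filter ι} {r : ι → ℝ}
    (hr : Tendsto r l (𝓝 0)) (hr0 : ∀ᶠ i in l, r i ≠ 0) {T : ι → E →L[ℂ] E}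
    (hest : ∀ i, ∀ x y : A.domain,
      ‖T i x - x - r i • A x‖ ≤ |r i| * (2 * ‖A x - y‖ + |r i| * ‖A y‖)) (x : A.domain) :
    Tendsto (fun i => ((r i : ℝ) : ℂ)⁻¹ • (T i x - x)) l (𝓝 (A x)) := by
  rw [Metric.tendsto_nhds]
  intro ε hε
  obtain ⟨d, hd, hxd⟩ := Metric.mem_closure_iff.mp (hdense (A x)) (ε / 4) (by positivity)
  have h0 : Tendsto (fun i => |r i| * ‖A ⟨d, hd⟩‖) l (𝓝 0) := by
    simpa using hr.abs.mul_const ‖A ⟨d, hd⟩‖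
  filter_upwards [h0.eventually_lt_const (show (0 : ℝ) < ε / 4 by positivity), hr0] with i hi hi0
  have h1 : ((r i : ℝ) : ℂ)⁻¹ • (T i x - x) - A x
      = ((r i : ℝ) : ℂ)⁻¹ • (T i x - x - r i • A x) := by
    rw [smul_sub _ (T i x - x), ← Complex.coe_smul (r i), smul_smul,
      inv_mul_cancel₀ (by exact_mod_cast hi0), one_smul]
  have hpos : 0 < |r i| := abs_pos.mpr hi0
  rw [dist_eq_norm, h1, norm_smul, norm_inv, Complex.norm_real, Real.norm_eq_abs,
    inv_mul_lt_iff₀ hpos]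
  refine (hest i x ⟨d, hd⟩).trans_lt ?_
  rw [dist_eq_norm] at hxd
  exact mul_lt_mul_of_pos_left (by simp only; linarith) hpos

end Limit

/-! ### Resolvents of dissipative operators -/

section Resolvent

variable {E : Type*} [NormedAddCommGroup E] [InnerProductSpace ℂ E]

theorem re_inner_real_smul_left (r : ℝ) (x y : E) :
    (inner ℂ (r • x) y).re = r * (inner ℂ x y).re := by
  rw [← Complex.coe_smul, inner_smul_left]
  simp

theorem re_inner_real_smul_right (r : ℝ) (x y : E) :
    (inner ℂ x (r • y)).re = r * (inner ℂ x y).re := by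
  rw [← Complex.coe_smul, inner_smul_right]
  simp

theorem re_inner_self (x : E) : (inner ℂ x x).re = ‖x‖ ^ 2 := by
  simpa using inner_self_eq_norm_sq (𝕜 := ℂ) x

theorem re_inner_comm (x y : E) : (inner ℂ x y).re = (inner ℂ y x).re := by
  simpa using inner_re_symm (𝕜 := ℂ) x y

/-- Cauchy–Schwarz for `⟨μx - Ax, x⟩`. The factor `μ` in the hypothesis lets negative `μ` be covered
when `A` is skew. -/
theorem LinearPMap.abs_mul_norm_le_norm_smul_sub {A : E →ₗ.[ℂ] E} {μ : ℝ}
    (hdis : ∀ x : A.domain, μ * (inner ℂ (A x) (x : E)).re ≤ 0) (x : A.domain) :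
    |μ| * ‖(x : E)‖ ≤ ‖μ • (x : E) - A x‖ := by
  rcases eq_or_ne μ 0 with rfl | hμ
  · simp
  rcases eq_or_ne (x : E) 0 with hx | hx
  · simp [hx]
  have h1 : |μ| ^ 2 * ‖(x : E)‖ ^ 2 ≤ |μ| * (‖μ • (x : E) - A x‖ * ‖(x : E)‖) := by
    have h2 : (inner ℂ (μ • (x : E) - A x) (x : E)).re
        = μ * ‖(x : E)‖ ^ 2 - (inner ℂ (A x) (x : E)).re := by
      rw [inner_sub_left, Complex.sub_re, re_inner_real_smul_left, re_inner_self]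
    have h3 : |(inner ℂ (μ • (x : E) - A x) (x : E)).re| ≤ ‖μ • (x : E) - A x‖ * ‖(x : E)‖ :=
      (Complex.abs_re_le_norm _).trans (norm_inner_le_norm _ _)
    have h4 : |μ| ^ 2 * ‖(x : E)‖ ^ 2 ≤ μ * (inner ℂ (μ • (x : E) - A x) (x : E)).re := by
      rw [h2, sq_abs]
      nlinarith [hdis x]
    refine h4.trans ((le_abs_self _).trans ?_)
    rw [abs_mul]
    gcongr
  have hμ' : 0 < |μ| := abs_pos.mpr hμ
  have hx' : 0 < ‖(x : E)‖ := norm_pos_iff.mpr hx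
  have : (|μ| * ‖(x : E)‖) * (|μ| * ‖(x : E)‖) ≤ ‖μ • (x : E) - A x‖ * (|μ| * ‖(x : E)‖) := by
    nlinarith
  exact le_of_mul_le_mul_right this (by positivity)

theorem LinearPMap.abs_mul_norm_le_norm_coe_smul_sub {A : E →ₗ.[ℂ] E} {μ : ℝ}
    (hdis : ∀ x : A.domain, μ * (inner ℂ (A x) (x : E)).re ≤ 0) (x : A.domain) :
    |μ| * ‖(x : E)‖ ≤ ‖(μ : ℂ) • (x : E) - A x‖ := by
  rw [Complex.coe_smul]
  exact A.abs_mul_norm_le_norm_smul_sub hdis x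

/-- `R` is the bounded inverse of `μ - A`. -/
structure LinearPMap.IsResolventAt (A : E →ₗ.[ℂ] E) (μ : ℝ) (R : E →L[ℂ] E) : Prop where
  exists_eq : ∀ y, ∃ x : A.domain, (x : E) = R y ∧ μ • (x : E) - A x = y
  apply_sub : ∀ x : A.domain, R (μ • (x : E) - A x) = x
  norm_le : ∀ y, |μ| * ‖R y‖ ≤ ‖y‖

/-- The lower bound for `μ - A` yields both injectivity and continuity of the inverse, so closedness
of `A` plays no role. -/
theorem LinearPMap.exists_isResolventAt {A : E →ₗ.[ℂ] E} {μ : ℝ} (hμ : μ ≠ 0)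
    (hdis : ∀ x : A.domain, μ * (inner ℂ (A x) (x : E)).re ≤ 0)
    (hrange : ∀ y, ∃ x : A.domain, μ • (x : E) - A x = y) :
    ∃ R : E →L[ℂ] E, A.IsResolventAt μ R := by
  have hμ' : 0 < |μ| := abs_pos.mpr hμ
  let F : A.domain →ₗ[ℂ] E := (μ : ℂ) • A.domain.subtype - A.toFun
  have hF : ∀ x, F x = μ • (x : E) - A x := fun x => by
    simp only [F, LinearMap.sub_apply, LinearMap.smul_apply, Submodule.subtype_apply,
      Complex.coe_smul, LinearPMap.toFun_eq_coe]
  have hinj : Function.Injective F := by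
    rw [← LinearMap.ker_eq_bot, LinearMap.ker_eq_bot']
    intro x hx
    have h := A.abs_mul_norm_le_norm_smul_sub hdis x
    rw [← hF, hx, norm_zero] at h
    have : ‖(x : E)‖ ≤ 0 := by
      by_contra hne
      exact absurd h (not_le.mpr (mul_pos hμ' (not_le.mp hne)))
    exact Subtype.ext (norm_le_zero_iff.mp this)
  have hsurj : Function.Surjective F := fun y => by
    obtain ⟨x, hx⟩ := hrange y
    exact ⟨x, (hF x).trans hx⟩
  let e := LinearEquiv.ofBijective F ⟨hinj, hsurj⟩
  have he : ∀ x, e x = μ • (x : E) - A x := hF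
  have hes : ∀ y, μ • ((e.symm y : A.domain) : E) - A (e.symm y) = y := fun y => by
    rw [← he, LinearEquiv.apply_symm_apply]
  have hbound : ∀ y, |μ| * ‖((e.symm y : A.domain) : E)‖ ≤ ‖y‖ := fun y => by
    simpa only [hes] using A.abs_mul_norm_le_norm_smul_sub hdis (e.symm y)
  refine ⟨(A.domain.subtype ∘ₗ e.symm.toLinearMap).mkContinuous |μ|⁻¹ fun y => ?_,
    fun y => ⟨e.symm y, rfl, hes y⟩, fun x => ?_, fun y => hbound y⟩
  · rw [le_inv_mul_iff₀ hμ']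
    exact hbound y
  · change ((e.symm (μ • (x : E) - A x) : A.domain) : E) = x
    rw [← he, LinearEquiv.symm_apply_apply]

namespace LinearPMap.IsResolventAt

variable {A : E →ₗ.[ℂ] E} {μ ν : ℝ} {R S : E →L[ℂ] E}

theorem apply_sub_apply (hR : A.IsResolventAt μ R) (hS : A.IsResolventAt ν S) (y : E) :
    R y - S y = (ν - μ) • R (S y) := by
  obtain ⟨v, hv, hvy⟩ := hS.exists_eq y
  have h1 : y = (μ • (v : E) - A v) + (ν - μ) • (v : E) := by
    rw [← hvy, sub_smul]; abel
  rw [← hv]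
  nth_rw 1 [h1]
  rw [_root_.map_add, hR.apply_sub, R.map_smul_of_tower, add_sub_cancel_left]

/-- For `μ ≠ ν`, write the resolvent identity in both orders and cancel the scalar; for `μ = ν` it
says `R = S`. -/
theorem commute (hR : A.IsResolventAt μ R) (hS : A.IsResolventAt ν S) : Commute R S := by
  ext y
  change R (S y) = S (R y)
  rcases eq_or_ne μ ν with rfl | hne
  · have h : ∀ y, R y = S y := fun y => by simpa [sub_eq_zero] using hR.apply_sub_apply hS y
    rw [h, h]
  · have h1 := hR.apply_sub_apply hS y
    have h2 := hS.apply_sub_apply hR y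
    rw [← neg_sub (R y) (S y), h1, ← neg_sub ν μ, neg_smul, neg_inj] at h2
    exact smul_right_injective E (sub_ne_zero.mpr hne.symm) h2

end LinearPMap.IsResolventAt

/-- The Yosida approximation `μ² (μ - A)⁻¹ - μ` of `A`, in terms of the resolvent `R`. -/
noncomputable def yosida (μ : ℝ) (R : E →L[ℂ] E) : E →L[ℂ] E :=
  (μ ^ 2) • R - μ • ContinuousLinearMap.id ℂ E

theorem yosida_apply (μ : ℝ) (R : E →L[ℂ] E) (x : E) :
    yosida μ R x = (μ ^ 2) • R x - μ • x := by
  simp [yosida]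

theorem Commute.yosida {μ ν : ℝ} {R S : E →L[ℂ] E} (h : Commute R S) :
    Commute (yosida μ R) (yosida ν S) := by
  have h1 : ∀ T : E →L[ℂ] E, Commute T (ContinuousLinearMap.id ℂ E) := Commute.one_right
  refine Commute.sub_left (Commute.sub_right ?_ ?_) (Commute.sub_right ?_ ?_)
  · exact (h.smul_left _).smul_right _
  · exact (h1 _).smul_right _
  · exact ((h1 _).symm.smul_left _).smul_right _
  · exact ((h1 _).smul_left _).smul_right _

theorem LinearPMap.IsResolventAt.yosida_apply_eq {A : E →ₗ.[ℂ] E} {μ : ℝ} {R : E →L[ℂ] E}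
    (hR : A.IsResolventAt μ R) (x : A.domain) : yosida μ R x = μ • R (A x) := by
  have h := hR.apply_sub x
  rw [_root_.map_sub, R.map_smul_of_tower, sub_eq_iff_eq_add] at h
  rw [yosida_apply, pow_two, mul_smul, h, smul_add, add_sub_cancel_left]

/-- With `x = Ry` the approximation sends `y = μx - Ax` to `μAx`, so the form is `μ² Re⟨Ax, x⟩ -
μ‖Ax‖²`. -/
theorem LinearPMap.IsResolventAt.re_inner_yosida_nonpos {A : E →ₗ.[ℂ] E} {μ : ℝ}
    {R : E →L[ℂ] E} (hR : A.IsResolventAt μ R) (hμ : 0 ≤ μ)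
    (hdis : ∀ x : A.domain, (inner ℂ (A x) (x : E)).re ≤ 0) (y : E) :
    (inner ℂ (yosida μ R y) y).re ≤ 0 := by
  obtain ⟨x, hx, hxy⟩ := hR.exists_eq y
  have h1 : yosida μ R y = μ • A x := by
    rw [yosida_apply, ← hx, ← hxy, smul_sub, smul_smul, pow_two]; abel
  rw [h1, ← hxy, inner_sub_right, Complex.sub_re, re_inner_real_smul_left,
    re_inner_real_smul_left, re_inner_real_smul_right, re_inner_self]
  have h2 := mul_nonpos_of_nonneg_of_nonpos (mul_nonneg hμ hμ) (hdis x)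
  have h3 := mul_nonneg hμ (sq_nonneg ‖A x‖)
  linarith

/-- One Yosida approximation of a skew operator is only dissipative. The sum over `±μ` is formally
`2μ²A(μ² - A²)⁻¹`, an odd function of `A`, hence skew again. -/
theorem LinearPMap.IsResolventAt.re_inner_yosida_add {A : E →ₗ.[ℂ] E} {μ : ℝ}
    {R S : E →L[ℂ] E} (hR : A.IsResolventAt μ R) (hS : A.IsResolventAt (-μ) S)
    (hskew : ∀ x : A.domain, (inner ℂ (A x) (x : E)).re = 0) (y : E) :
    (inner ℂ ((yosida μ R + yosida (-μ) S) y) y).re = 0 := by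
  obtain ⟨x, hx, hxy⟩ := hR.exists_eq y
  obtain ⟨w, hw, hwy⟩ := hS.exists_eq y
  have h1 : (yosida μ R + yosida (-μ) S) y = μ ^ 2 • ((x : E) + w) := by
    rw [_root_.add_apply, yosida_apply, yosida_apply, hx, hw, neg_sq, neg_smul,
      smul_add]
    abel
  have h2 : (inner ℂ (A x) (w : E)).re + (inner ℂ (A w) (x : E)).re = 0 := by
    have h := hskew (x + w)
    rw [LinearPMap.map_add, Submodule.coe_add, inner_add_left, inner_add_right,
      inner_add_right] at h
    simp only [Complex.add_re] at h
    linarith [hskew x, hskew w]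
  -- Each product with `y` is expanded through the opposite resolvent, so only mixed terms in `x`
  -- and `w` occur.
  have h3 : (inner ℂ (x : E) y).re = -(μ * (inner ℂ (x : E) (w : E)).re)
      - (inner ℂ (A w) (x : E)).re := by
    rw [← hwy, inner_sub_right, Complex.sub_re, re_inner_real_smul_right, re_inner_comm _ (A w)]
    ring
  have h4 : (inner ℂ (w : E) y).re = μ * (inner ℂ (x : E) (w : E)).re
      - (inner ℂ (A x) (w : E)).re := by
    rw [← hxy, inner_sub_right, Complex.sub_re, re_inner_real_smul_right, re_inner_comm _ (A x),
      re_inner_comm (w : E)]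
  rw [h1, re_inner_real_smul_left, inner_add_left, Complex.add_re, h3, h4]
  linear_combination (-μ ^ 2) * h2

/-- If `y ⟂ D(A)` and `x - Ax = y`, then `0 = Re⟨y, x⟩ ≥ ‖x‖²`. -/
theorem LinearPMap.dense_domain {A : E →ₗ.[ℂ] E} [CompleteSpace E]
    (hdis : ∀ x : A.domain, (inner ℂ (A x) (x : E)).re ≤ 0)
    (hrange : ∀ y, ∃ x : A.domain, (1 : ℝ) • (x : E) - A x = y) :
    Dense (A.domain : Set E) := by
  rw [Submodule.dense_iff_topologicalClosure_eq_top, Submodule.topologicalClosure_eq_top_iff,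
    Submodule.eq_bot_iff]
  intro y hy
  obtain ⟨x, hxy⟩ := hrange y
  have h0 : inner ℂ y (x : E) = 0 := Submodule.inner_left_of_mem_orthogonal x.2 hy
  have h1 := congrArg Complex.re h0
  rw [← hxy, one_smul, inner_sub_left, Complex.sub_re, re_inner_self, Complex.zero_re] at h1
  have h2 : ‖(x : E)‖ = 0 := by
    have := hdis x
    exact pow_eq_zero_iff two_ne_zero |>.mp (le_antisymm (by linarith) (sq_nonneg _))
  have h3 : x = 0 := Subtype.ext (norm_eq_zero.mp h2)
  rw [← hxy, h3]
  simp

/-- Strong convergence of the Yosida approximations along `|μ k| → ∞`. -/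
theorem LinearPMap.tendsto_yosida {A : E →ₗ.[ℂ] E} (hdense : Dense (A.domain : Set E))
    {μ : ℕ → ℝ} (hμ0 : ∀ k, μ k ≠ 0) (hμ : Tendsto (fun k => |μ k|) atTop atTop)
    {R : ℕ → E →L[ℂ] E} (hR : ∀ k, A.IsResolventAt (μ k) (R k)) (x : A.domain) :
    Tendsto (fun k => yosida (μ k) (R k) x) atTop (𝓝 (A x)) := by
  have hinv : ∀ c : ℝ, Tendsto (fun k => |μ k|⁻¹ * c) atTop (𝓝 0) := fun c => by
    simpa using hμ.inv_tendsto_atTop.mul_const c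
  simp only [(hR _).yosida_apply_eq]
  rw [Metric.tendsto_nhds]
  intro ε hε
  obtain ⟨d, hd, hxd⟩ := Metric.mem_closure_iff.mp (hdense (A x)) (ε / 3) (by positivity)
  filter_upwards [(hinv ‖A ⟨d, hd⟩‖).eventually_lt_const (show (0 : ℝ) < ε / 3 by positivity)]
    with k hk
  have hpos : 0 < |μ k| := abs_pos.mpr (hμ0 k)
  have h1 : ‖μ k • R k (A x - d)‖ ≤ ‖A x - d‖ := by
    rw [norm_smul, Real.norm_eq_abs]; exact (hR k).norm_le _
  have h2 : μ k • R k d - d = R k (A ⟨d, hd⟩) := by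
    have h := (hR k).apply_sub ⟨d, hd⟩
    rw [_root_.map_sub, (R k).map_smul_of_tower, sub_eq_iff_eq_add] at h
    rw [h, add_sub_cancel_left]
  have h3 : ‖R k (A ⟨d, hd⟩)‖ ≤ |μ k|⁻¹ * ‖A ⟨d, hd⟩‖ := by
    rw [le_inv_mul_iff₀ hpos]; exact (hR k).norm_le _
  have h4 : μ k • R k (A x) - A x
      = μ k • R k (A x - d) + (μ k • R k d - d) - (A x - d) := by
    rw [_root_.map_sub, smul_sub]; abel
  rw [dist_eq_norm] at hxd ⊢
  rw [h4, h2]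
  have h5 := norm_sub_le (μ k • R k (A x - d) + R k (A ⟨d, hd⟩)) (A x - d)
  have h6 := norm_add_le (μ k • R k (A x - d)) (R k (A ⟨d, hd⟩))
  linarith

end Resolvent

/-! ### Generation theorems -/

section Generation

variable {E : Type*} [NormedAddCommGroup E] [InnerProductSpace ℂ E]

open NormedSpace

theorem re_inner_inv_smul_sub_nonpos {T : E →L[ℂ] E} (hT : ‖T‖ ≤ 1) {r : ℝ} (hr : 0 ≤ r) (x : E) :
    (inner ℂ (((r : ℝ) : ℂ)⁻¹ • (T x - x)) x).re ≤ 0 := by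
  have h1 : (inner ℂ (T x) x).re ≤ ‖x‖ ^ 2 := by
    refine (Complex.re_le_norm _).trans ((norm_inner_le_norm _ _).trans ?_)
    rw [pow_two]
    gcongr
    simpa using T.le_of_opNorm_le hT x
  rw [← Complex.ofReal_inv, Complex.coe_smul, re_inner_real_smul_left, inner_sub_left,
    Complex.sub_re, re_inner_self]
  exact mul_nonpos_of_nonneg_of_nonpos (inv_nonneg.mpr hr) (by linarith)

theorem re_inner_nonpos_of_tendsto {ι : Type*} {l : Filter ι} [l.NeBot] {r : ι → ℝ}
    (hr : ∀ᶠ i in l, 0 < r i) {T : ι → E →L[ℂ] E} (hT : ∀ i, ‖T i‖ ≤ 1) {x y : E}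
    (h : Tendsto (fun i => ((r i : ℝ) : ℂ)⁻¹ • (T i x - x)) l (𝓝 y)) :
    (inner ℂ y x).re ≤ 0 := by
  have h1 := (Complex.continuous_re.tendsto _).comp (h.inner (𝕜 := ℂ) (tendsto_const_nhds (x := x)))
  refine le_of_tendsto h1 ?_
  filter_upwards [hr] with i hi
  exact re_inner_inv_smul_sub_nonpos (hT i) hi.le x

/-- A dissipative extension of `A` cannot be proper once `1 - A` is onto: solve `z - Az = x - y`;
the difference quotients at `x - z` then tend to `x - z` itself, and dissipativity of the limit
forces `x = z`. The filter `l` is the one defining the generator (two-sided for groups);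
dissipativity is read off along the finer `l'`, where `r > 0`. -/
theorem mem_graph_iff_tendsto_of_estimate {A : E →ₗ.[ℂ] E} (hdense : Dense (A.domain : Set E))
    (hrange : ∀ y, ∃ x : A.domain, (1 : ℝ) • (x : E) - A x = y)
    {ι : Type*} {l l' : Filter ι} [l'.NeBot] (hl : l' ≤ l) {r : ι → ℝ}
    (hr : Tendsto r l (𝓝 0)) (hr0 : ∀ᶠ i in l, r i ≠ 0) (hr' : ∀ᶠ i in l', 0 < r i)
    {T : ι → E →L[ℂ] E} (hT : ∀ i, ‖T i‖ ≤ 1)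
    (hest : ∀ i, ∀ x y : A.domain,
      ‖T i x - x - r i • A x‖ ≤ |r i| * (2 * ‖A x - y‖ + |r i| * ‖A y‖)) (x y : E) :
    (x, y) ∈ A.graph ↔ Tendsto (fun i => ((r i : ℝ) : ℂ)⁻¹ • (T i x - x)) l (𝓝 y) := by
  rw [LinearPMap.mem_graph_iff]
  constructor
  · rintro ⟨z, rfl, rfl⟩
    exact tendsto_inv_smul_of_estimate hdense hr hr0 hest z
  · intro h
    obtain ⟨z, hz⟩ := hrange (x - y)
    rw [one_smul] at hz
    have h1 := h.sub (tendsto_inv_smul_of_estimate hdense hr hr0 hest z)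
    have h2 : y - A z = x - z := by
      have : A z = z - (x - y) := by rw [← hz]; abel
      rw [this]; abel
    have h3 : Tendsto (fun i => ((r i : ℝ) : ℂ)⁻¹ • (T i (x - z) - (x - z))) l' (𝓝 (x - z)) := by
      rw [h2] at h1
      refine (h1.mono_left hl).congr fun i => ?_
      rw [← smul_sub, map_sub]
      congr 1
      abel
    have h4 := re_inner_nonpos_of_tendsto hr' hT h3
    rw [re_inner_self] at h4
    have h5 : ‖x - z‖ = 0 := pow_eq_zero_iff two_ne_zero |>.mp (le_antisymm h4 (sq_nonneg _))
    have h6 : x - z = 0 := norm_eq_zero.mp h5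
    exact ⟨z, (sub_eq_zero.mp h6).symm, (sub_eq_zero.mp (h2.trans h6)).symm⟩

theorem tendsto_apply_of_contraction {F : ℕ → E →L[ℂ] E} (hF : ∀ k x, ‖F k x‖ ≤ ‖x‖)
    {T : E →L[ℂ] E} (hT : ∀ x, Tendsto (fun k => F k x) atTop (𝓝 (T x))) {u : ℕ → E} {v : E}
    (hu : Tendsto u atTop (𝓝 v)) : Tendsto (fun k => F k (u k)) atTop (𝓝 (T v)) := by
  have h1 : Tendsto (fun k => F k (u k - v)) atTop (𝓝 0) :=
    squeeze_zero_norm (fun k => hF k _) (by simpa using (hu.sub_const v).norm)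
  have h2 := h1.add (hT v)
  rw [zero_add] at h2
  refine h2.congr fun k => ?_
  rw [← map_add, sub_add_cancel]

theorem GeneratesContractionSemigroup.re_inner_nonpos {A : E →ₗ.[ℂ] E}
    (hA : GeneratesContractionSemigroup A) (x : A.domain) :
    (inner ℂ (A x) (x : E)).re ≤ 0 := by
  obtain ⟨T, hT, hgen⟩ := hA
  have h := (hgen x (A x)).mp (LinearPMap.mem_graph A x)
  have hpos : ∀ᶠ t : ℝ≥0 in 𝓝[>] 0, (0 : ℝ) < t := by
    filter_upwards [self_mem_nhdsWithin] with t ht using ht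
  exact re_inner_nonpos_of_tendsto hpos hT h

theorem GeneratesUnitaryGroup.re_inner_eq_zero {A : E →ₗ.[ℂ] E}
    (hA : GeneratesUnitaryGroup A) (x : A.domain) :
    (inner ℂ (A x) (x : E)).re = 0 := by
  obtain ⟨U, hU, hgen⟩ := hA
  have h := (hgen x (A x)).mp (LinearPMap.mem_graph A x)
  have hU1 : ∀ t, ‖U.toFun t‖ ≤ 1 := fun t =>
    (U.toFun t).opNorm_le_bound zero_le_one fun y => by
      rw [one_mul]
      refine le_of_eq ((sq_eq_sq₀ (norm_nonneg _) (norm_nonneg _)).mp ?_)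
      rw [← re_inner_self, (hU t).2, re_inner_self]
  refine le_antisymm ?_ ?_
  · refine re_inner_nonpos_of_tendsto (l := 𝓝[>] 0) (r := id) self_mem_nhdsWithin hU1
      (h.mono_left (nhdsWithin_mono _ fun _ h => (ne_of_gt h)))
  · have hneg : Tendsto (fun h : ℝ => -h) (𝓝[>] 0) (𝓝[≠] 0) := by
      refine tendsto_nhdsWithin_iff.mpr
        ⟨(continuous_neg.tendsto' 0 0 neg_zero).mono_left nhdsWithin_le_nhds, ?_⟩
      filter_upwards [self_mem_nhdsWithin] with t ht using neg_ne_zero.mpr (ne_of_gt ht)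
    have h2 := (h.comp hneg).neg
    have h3 := re_inner_nonpos_of_tendsto (l := 𝓝[>] 0) (r := id)
      (T := fun t => U.toFun (-t)) self_mem_nhdsWithin (fun t => hU1 (-t))
      (x := (x : E)) (y := -A x) (h2.congr fun t => by simp [inv_neg])
    rw [inner_neg_left, Complex.neg_re] at h3
    linarith

variable [CompleteSpace E]

theorem exp_add_smul (B : E →L[ℂ] E) (s t : ℝ) :
    exp ((s + t) • B) = exp (s • B) * exp (t • B) := by
  let +nondep : NormedAlgebra ℚ (E →L[ℂ] E) := .restrictScalars ℚ ℂ (E →L[ℂ] E)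
  rw [add_smul]
  exact exp_add_of_commute (((Commute.refl B).smul_left s).smul_right t)

theorem eq_comp_of_tendsto_exp {B : ℕ → E →L[ℂ] E} {s t : ℝ} {S T U : E →L[ℂ] E}
    (hB : ∀ k x, (inner ℂ ((s • B k) x) x).re ≤ 0)
    (hS : ∀ x, Tendsto (fun k => exp (s • B k) x) atTop (𝓝 (S x)))
    (hT : ∀ x, Tendsto (fun k => exp (t • B k) x) atTop (𝓝 (T x)))
    (hU : ∀ x, Tendsto (fun k => exp ((s + t) • B k) x) atTop (𝓝 (U x))) :
    U = S.comp T := by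
  ext x
  refine tendsto_nhds_unique (hU x) ?_
  simp only [exp_add_smul]
  exact tendsto_apply_of_contraction (fun k => norm_exp_apply_le (hB k)) hS (hT x)

theorem eq_id_of_tendsto_exp_zero {B : ℕ → E →L[ℂ] E} {T : E →L[ℂ] E}
    (hT : ∀ x, Tendsto (fun k => exp ((0 : ℝ) • B k) x) atTop (𝓝 (T x))) :
    T = ContinuousLinearMap.id ℂ E := by
  ext x
  refine tendsto_nhds_unique (hT x) ?_
  simp

/-- The Lumer–Phillips theorem in Hilbert spaces. -/
theorem generatesContractionSemigroup_of_dissipative {A : E →ₗ.[ℂ] E}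
    (hdis : ∀ x : A.domain, (inner ℂ (A x) (x : E)).re ≤ 0)
    (hrange : ∀ μ : ℝ, 0 < μ → ∀ y, ∃ x : A.domain, μ • (x : E) - A x = y) :
    GeneratesContractionSemigroup A := by
  have hdense := A.dense_domain hdis (hrange 1 one_pos)
  -- The resolvent points are `k + 1`, so that `k = 0` is admissible.
  have hμ : ∀ k : ℕ, (0 : ℝ) < k + 1 := fun k => by positivity
  choose R hR using fun k : ℕ => A.exists_isResolventAt (hμ k).ne'
    (fun x => mul_nonpos_of_nonneg_of_nonpos (hμ k).le (hdis x)) (hrange _ (hμ k))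
  have hlim := LinearPMap.tendsto_yosida hdense (fun k => (hμ k).ne')
    (tendsto_abs_atTop_atTop.comp
      (tendsto_natCast_atTop_atTop.atTop_add (tendsto_const_nhds (x := (1 : ℝ))))) hR
  have hB : ∀ (t : ℝ≥0) (k : ℕ) x, (inner ℂ (((t : ℝ) • yosida ((k : ℝ) + 1) (R k)) x) x).re ≤ 0 :=
    fun t k x => re_inner_real_smul_nonpos t.2 ((hR k).re_inner_yosida_nonpos (hμ k).le hdis x)
  choose T hT1 hTlim hest using fun t : ℝ≥0 => exists_tendsto_exp_smul hdense
    (fun j k => ((hR j).commute (hR k)).yosida) hlim (hB t)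
  have hcoe : Tendsto (fun t : ℝ≥0 => (t : ℝ)) (𝓝[>] 0) (𝓝 0) :=
    (NNReal.continuous_coe.tendsto' 0 0 rfl).mono_left nhdsWithin_le_nhds
  have hpos : ∀ᶠ t : ℝ≥0 in 𝓝[>] 0, (0 : ℝ) < t := by
    filter_upwards [self_mem_nhdsWithin] with t ht using ht
  refine ⟨⟨T, eq_id_of_tendsto_exp_zero (hTlim 0), fun s t => eq_comp_of_tendsto_exp (hB s)
    (hTlim s) (hTlim t) (hTlim (s + t)), tendsto_apply_of_estimate hdense hcoe hT1 hest⟩, hT1, ?_⟩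
  exact mem_graph_iff_tendsto_of_estimate hdense (hrange 1 one_pos) le_rfl hcoe
    (hpos.mono fun _ h => h.ne') hpos hT1 hest

/-- Stone's theorem: a skew-symmetric operator `A` with `μ - A` onto for all real `μ ≠ 0` generates
a unitary group. -/
theorem generatesUnitaryGroup_of_skew {A : E →ₗ.[ℂ] E}
    (hskew : ∀ x : A.domain, (inner ℂ (A x) (x : E)).re = 0)
    (hrange : ∀ μ : ℝ, μ ≠ 0 → ∀ y, ∃ x : A.domain, μ • (x : E) - A x = y) :
    GeneratesUnitaryGroup A := by
  have hdense := A.dense_domain (fun x => (hskew x).le) (hrange 1 one_ne_zero)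
  have hμ : ∀ k : ℕ, (k : ℝ) + 1 ≠ 0 := fun k => by positivity
  choose R hR using fun k : ℕ => A.exists_isResolventAt (hμ k)
    (fun x => by rw [hskew x, mul_zero]) (hrange _ (hμ k))
  choose S hS using fun k : ℕ => A.exists_isResolventAt (neg_ne_zero.mpr (hμ k))
    (fun x => by rw [hskew x, mul_zero]) (hrange _ (neg_ne_zero.mpr (hμ k)))
  have habs : Tendsto (fun k : ℕ => |(k : ℝ) + 1|) atTop atTop :=
    tendsto_abs_atTop_atTop.comp
      (tendsto_natCast_atTop_atTop.atTop_add (tendsto_const_nhds (x := (1 : ℝ))))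
  -- Averaging the approximations at `±(k + 1)` keeps the limit `A` and makes every `B k` skew, so
  -- `t • B k` is dissipative for both signs of `t`.
  let B : ℕ → E →L[ℂ] E := fun k =>
    (1 / 2 : ℝ) • (yosida ((k : ℝ) + 1) (R k) + yosida (-((k : ℝ) + 1)) (S k))
  have hlim : ∀ x : A.domain, Tendsto (fun k => B k x) atTop (𝓝 (A x)) := by
    intro x
    have h1 := LinearPMap.tendsto_yosida hdense hμ habs hR x
    have h2 := LinearPMap.tendsto_yosida hdense (fun k => neg_ne_zero.mpr (hμ k))
      (by simpa only [abs_neg] using habs) hS x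
    have h3 := (h1.add h2).const_smul (1 / 2 : ℝ)
    rwa [← two_smul ℝ, smul_smul, one_div_mul_cancel two_ne_zero, one_smul] at h3
  have hcomm : ∀ j k, Commute (B j) (B k) := by
    intro j k
    refine ((Commute.add_left ?_ ?_).smul_left _).smul_right _
    · exact ((hR j).commute (hR k)).yosida.add_right ((hR j).commute (hS k)).yosida
    · exact ((hS j).commute (hR k)).yosida.add_right ((hS j).commute (hS k)).yosida
  have hB : ∀ (t : ℝ) k x, (inner ℂ ((t • B k) x) x).re ≤ 0 := by
    intro t k x
    refine le_of_eq ?_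
    rw [smul_apply, re_inner_real_smul_left, smul_apply, re_inner_real_smul_left,
      (hR k).re_inner_yosida_add (hS k) hskew, mul_zero, mul_zero]
  choose U hU1 hUlim hest using fun t : ℝ => exists_tendsto_exp_smul hdense hcomm hlim (hB t)
  have hzero : U 0 = ContinuousLinearMap.id ℂ E := eq_id_of_tendsto_exp_zero (hUlim 0)
  have hadd : ∀ s t, U (s + t) = (U s).comp (U t) := fun s t =>
    eq_comp_of_tendsto_exp (hB s) (hUlim s) (hUlim t) (hUlim (s + t))
  have hcancel : ∀ t x, U t (U (-t) x) = x := fun t x => by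
    have := congrArg (fun F : E →L[ℂ] E => F x) (hadd t (-t))
    simpa [hzero] using this.symm
  have hle : ∀ t x, ‖U t x‖ ≤ ‖x‖ := fun t x => by simpa using (U t).le_of_opNorm_le (hU1 t) x
  -- `U t` and its inverse `U (-t)` are both contractions.
  have hiso : ∀ t x, ‖U t x‖ = ‖x‖ := fun t x => by
    refine le_antisymm (hle t x) ?_
    have h := hle (-t) (U t x)
    have h2 := hcancel (-t) x
    rw [neg_neg] at h2
    rwa [h2] at h
  refine ⟨⟨U, hzero, hadd, tendsto_apply_of_estimate hdense tendsto_id hU1 hest⟩,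
    fun t => ⟨fun y => ⟨U (-t) y, hcancel t y⟩, ?_⟩, ?_⟩
  · exact (⟨(U t).toLinearMap, hiso t⟩ : E →ₗᵢ[ℂ] E).inner_map_map
  · exact mem_graph_iff_tendsto_of_estimate (l' := 𝓝[>] 0) hdense (hrange 1 one_ne_zero)
      (nhdsWithin_mono _ fun _ h => (ne_of_gt h)) (tendsto_id.mono_left nhdsWithin_le_nhds)
      self_mem_nhdsWithin self_mem_nhdsWithin hU1 hest

end Generation

/-! ### Primitives of integrable functions on `[0,1]` -/

section Primitive

variable {V W Z : Type*} [NormedAddCommGroup V] [NormedSpace ℝ V]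
  [NormedAddCommGroup W] [NormedSpace ℝ W] [NormedAddCommGroup Z] [NormedSpace ℝ Z]

/-- Two majorants are allowed because increments of a product involve both factors; a single
majorant is passed twice. -/
theorem AbsolutelyContinuousOnInterval.of_dist_le {X Y₁ Y₂ : Type*} [PseudoMetricSpace X]
    [PseudoMetricSpace Y₁] [PseudoMetricSpace Y₂] {f : ℝ → X} {φ : ℝ → Y₁} {ψ : ℝ → Y₂}
    {a b C : ℝ} (hφ : AbsolutelyContinuousOnInterval φ a b)
    (hψ : AbsolutelyContinuousOnInterval ψ a b)
    (h : ∀ s ∈ uIcc a b, ∀ t ∈ uIcc a b,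
      dist (f s) (f t) ≤ C * (dist (φ s) (φ t) + dist (ψ s) (ψ t))) :
    AbsolutelyContinuousOnInterval f a b := by
  have h0 := (Tendsto.add hφ hψ).const_mul C
  rw [add_zero, mul_zero] at h0
  refine squeeze_zero' (.of_forall fun E => Finset.sum_nonneg fun _ _ => dist_nonneg) ?_ h0
  filter_upwards [mem_inf_of_right (mem_principal_self _)] with E hE
  rw [← Finset.sum_add_distrib, Finset.mul_sum]
  exact Finset.sum_le_sum fun i hi => h _ (hE.1 i hi).1 _ (hE.1 i hi).2

theorem IntervalIntegrable.absolutelyContinuousOnInterval_integral {g : ℝ → V} {a b : ℝ}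
    (hg : IntervalIntegrable g volume a b) :
    AbsolutelyContinuousOnInterval (fun t => ∫ s in a..t, g s) a b := by
  have hn := hg.norm.absolutelyContinuousOnInterval_intervalIntegral (c := a) left_mem_uIcc
  have hsub : ∀ s ∈ uIcc a b, IntervalIntegrable g volume a s := fun s hs =>
    hg.mono_set (uIcc_subset_uIcc_left hs)
  refine hn.of_dist_le hn (C := 1) fun s hs t ht => ?_
  have h1 : dist (∫ x in a..s, g x) (∫ x in a..t, g x)
      ≤ dist (∫ x in a..s, ‖g x‖) (∫ x in a..t, ‖g x‖) := by
    rw [dist_eq_norm, Real.dist_eq,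
      intervalIntegral.integral_interval_sub_left (hsub s hs) (hsub t ht),
      intervalIntegral.integral_interval_sub_left (hsub s hs).norm (hsub t ht).norm]
    exact intervalIntegral.norm_integral_le_abs_integral_norm
  rw [one_mul]
  exact h1.trans (le_add_of_nonneg_right dist_nonneg)

/-- `u` is a primitive on `[0,1]` of the integrable function `g`. -/
structure IsPrimitive (u g : ℝ → V) : Prop where
  intervalIntegrable : IntervalIntegrable g volume 0 1
  eq_add : ∀ t ∈ Icc (0 : ℝ) 1, u t = u 0 + ∫ s in (0 : ℝ)..t, g s

theorem IsPrimitive.absolutelyContinuousOnInterval {u g : ℝ → V} (h : IsPrimitive u g) :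
    AbsolutelyContinuousOnInterval u 0 1 := by
  have hac := h.1.absolutelyContinuousOnInterval_integral
  refine hac.of_dist_le hac (C := 1) fun s hs t ht => ?_
  rw [uIcc_of_le zero_le_one] at hs ht
  rw [h.2 s hs, h.2 t ht, dist_add_left, one_mul]
  exact le_add_of_nonneg_right dist_nonneg

theorem IsPrimitive.continuousOn {u g : ℝ → V} (h : IsPrimitive u g) :
    ContinuousOn u (Icc 0 1) := by
  simpa [uIcc_of_le zero_le_one] using h.absolutelyContinuousOnInterval.continuousOn

theorem isPrimitive_const (c : V) : IsPrimitive (fun _ => c) 0 :=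
  ⟨by simp [IntervalIntegrable.zero], by simp⟩

theorem isPrimitive_of_hasDerivAt [CompleteSpace V] {u g : ℝ → V} (h : ∀ t, HasDerivAt u (g t) t)
    (hg : Continuous g) : IsPrimitive u g := by
  refine ⟨hg.intervalIntegrable _ _, fun t _ => ?_⟩
  rw [intervalIntegral.integral_eq_sub_of_hasDerivAt (fun s _ => h s) (hg.intervalIntegrable _ _)]
  abel

theorem IsPrimitive.add {u g v h : ℝ → V} (hu : IsPrimitive u g) (hv : IsPrimitive v h) :
    IsPrimitive (fun t => u t + v t) (fun t => g t + h t) := by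
  refine ⟨hu.1.add hv.1, fun t ht => ?_⟩
  have hsub : uIcc 0 t ⊆ uIcc (0 : ℝ) 1 :=
    uIcc_subset_uIcc_left (by rwa [uIcc_of_le zero_le_one])
  rw [hu.2 t ht, hv.2 t ht, intervalIntegral.integral_add (hu.1.mono_set hsub)
    (hv.1.mono_set hsub)]
  abel

theorem IntervalIntegrable.bilinear_continuousOn (B : V →L[ℝ] W →L[ℝ] Z) {g : ℝ → V}
    {v : ℝ → W} (hg : IntervalIntegrable g volume 0 1) (hv : ContinuousOn v (Icc 0 1)) :
    IntervalIntegrable (fun t => B (g t) (v t)) volume 0 1 := by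
  obtain ⟨M, hM⟩ := isCompact_Icc.exists_bound_of_continuousOn hv
  rw [intervalIntegrable_iff_integrableOn_Icc_of_le zero_le_one] at hg ⊢
  have hvm := hv.aestronglyMeasurable (μ := volume) measurableSet_Icc
  refine Integrable.mono' (hg.norm.const_mul (‖B‖ * M))
    (B.aestronglyMeasurable_comp₂ hg.aestronglyMeasurable hvm) ?_
  filter_upwards [ae_restrict_mem measurableSet_Icc] with t ht
  refine (B.le_opNorm₂ _ _).trans ?_
  have := mul_le_mul_of_nonneg_left (hM t ht) (mul_nonneg (norm_nonneg B) (norm_nonneg (g t)))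
  linarith

/-- The product rule for primitives. -/
theorem IsPrimitive.bilinear [CompleteSpace V] [CompleteSpace W] [CompleteSpace Z]
    (B : V →L[ℝ] W →L[ℝ] Z) {u g : ℝ → V} {v h : ℝ → W}
    (hu : IsPrimitive u g) (hv : IsPrimitive v h) :
    IsPrimitive (fun t => B (u t) (v t)) (fun t => B (u t) (h t) + B (g t) (v t)) := by
  set k : ℝ → Z := fun t => B (u t) (h t) + B (g t) (v t) with hk
  have hI : uIcc (0 : ℝ) 1 = Icc 0 1 := uIcc_of_le zero_le_one
  have hkint : IntervalIntegrable k volume 0 1 :=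
    (hv.1.bilinear_continuousOn B.flip hu.continuousOn).add
      (hu.1.bilinear_continuousOn B hv.continuousOn)
  refine ⟨hkint, ?_⟩
  have hac1 : AbsolutelyContinuousOnInterval (fun t => B (u t) (v t)) 0 1 := by
    obtain ⟨M, hM⟩ := isCompact_Icc.exists_bound_of_continuousOn hu.continuousOn
    obtain ⟨N, hN⟩ := isCompact_Icc.exists_bound_of_continuousOn hv.continuousOn
    refine hu.absolutelyContinuousOnInterval.of_dist_le hv.absolutelyContinuousOnInterval
      (C := ‖B‖ * (max M N)) fun s hs t ht => ?_
    rw [hI] at hs ht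
    have h1 : B (u s) (v s) - B (u t) (v t) = B (u s - u t) (v s) + B (u t) (v s - v t) := by
      simp
    rw [dist_eq_norm, dist_eq_norm, dist_eq_norm, h1]
    refine (norm_add_le _ _).trans ?_
    have h2 : ‖B (u s - u t) (v s)‖ ≤ ‖B‖ * ‖u s - u t‖ * max M N :=
      (B.le_opNorm₂ _ _).trans (mul_le_mul_of_nonneg_left ((hN s hs).trans (le_max_right _ _))
        (by positivity))
    have h3 : ‖B (u t) (v s - v t)‖ ≤ ‖B‖ * max M N * ‖v s - v t‖ :=
      (B.le_opNorm₂ _ _).trans (mul_le_mul_of_nonneg_right (mul_le_mul_of_nonneg_left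
        ((hM t ht).trans (le_max_left _ _)) (norm_nonneg B)) (norm_nonneg _))
    linarith
  -- The difference between the product and the candidate integral is absolutely continuous with
  -- derivative zero almost everywhere, hence constant.
  have hac := hac1.sub hkint.absolutelyContinuousOnInterval_integral
  have hderiv : ∀ᵐ t, t ∈ uIcc (0 : ℝ) 1 →
      HasDerivAt ((fun t => B (u t) (v t)) - fun t => ∫ s in (0 : ℝ)..t, k s) 0 t := by
    -- The integral formulas hold only on `[0,1]`, so two-sided derivatives are available only at
    -- interior points.
    have hend : ∀ᵐ t : ℝ, t ≠ 0 ∧ t ≠ 1 :=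
      (Measure.ae_ne volume 0).and (Measure.ae_ne volume 1)
    filter_upwards [hu.1.ae_hasDerivAt_integral, hv.1.ae_hasDerivAt_integral,
      hkint.ae_hasDerivAt_integral, hend] with t h1 h2 h3 h4 ht
    have ht' : t ∈ Ioo (0 : ℝ) 1 := by
      rw [hI] at ht
      exact ⟨lt_of_le_of_ne ht.1 h4.1.symm, lt_of_le_of_ne ht.2 h4.2⟩
    have hnhds : ∀ᶠ s in 𝓝 t, s ∈ Icc (0 : ℝ) 1 := Icc_mem_nhds ht'.1 ht'.2
    have hud : HasDerivAt u (g t) t :=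
      ((h1 ht 0 left_mem_uIcc).const_add (u 0)).congr_of_eventuallyEq
        (hnhds.mono fun s hs => hu.2 s hs)
    have hvd : HasDerivAt v (h t) t :=
      ((h2 ht 0 left_mem_uIcc).const_add (v 0)).congr_of_eventuallyEq
        (hnhds.mono fun s hs => hv.2 s hs)
    simpa [hk] using (B.hasDerivAt_of_bilinear (u := u) (v := v) (fun _ => hud) (fun _ => hvd)).sub
      (h3 ht 0 left_mem_uIcc)
  obtain ⟨C, hC⟩ := hac.const_of_ae_hasDerivAt_zero hderiv
  intro t ht
  have h1 := hC t (by rwa [hI])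
  have h0 := hC 0 left_mem_uIcc
  simp only [Pi.sub_apply, intervalIntegral.integral_same, sub_zero] at h0 h1
  rw [h0, ← h1, sub_add_cancel]

end Primitive

/-! ### Weak derivatives and primitives -/

section WeakDerivative

variable {n : ℕ}

theorem intervalIntegral_eq_setIntegral_Ioo {V : Type*} [NormedAddCommGroup V] [NormedSpace ℝ V]
    (f : ℝ → V) : ∫ t in (0 : ℝ)..1, f t = ∫ t in Ioo (0 : ℝ) 1, f t := by
  rw [intervalIntegral.integral_of_le zero_le_one, integral_Ioc_eq_integral_Ioo]

theorem intervalIntegrable_iff_integrable_unitInterval {V : Type*} [NormedAddCommGroup V]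
    {f : ℝ → V} : IntervalIntegrable f volume 0 1 ↔ Integrable f unitIntervalMeasure :=
  intervalIntegrable_iff_integrableOn_Ioo_of_le zero_le_one

theorem StateSpace.integrable (x : StateSpace n) : Integrable x unitIntervalMeasure :=
  (Lp.memLp x).integrable (by norm_num)

theorem StateSpace.intervalIntegrable (x : StateSpace n) : IntervalIntegrable x volume 0 1 :=
  intervalIntegrable_iff_integrable_unitInterval.mpr x.integrable

/-- Integrate the product rule for `φu`; the boundary terms vanish with `φ`. -/
theorem hasWeakDeriv_of_isPrimitive {x g : StateSpace n} {u : ℝ → EuclideanSpace ℂ (Fin n)}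
    (hu : IsPrimitive u g) (hx : x =ᵐ[unitIntervalMeasure] u) : HasWeakDeriv x g := by
  intro φ h1 h2 h3
  have hd : Continuous (deriv φ) := h1.continuous_deriv (by simp)
  have hφ : IsPrimitive φ (deriv φ) := isPrimitive_of_hasDerivAt
    (fun t => (h1.differentiable (by simp) t).hasDerivAt) hd
  have hzero : ∀ t, t ∉ Ioo (0 : ℝ) 1 → φ t = 0 := fun t ht => by
    by_contra hne
    exact ht (h3 (subset_tsupport φ hne))
  have hprod := hφ.bilinear (ContinuousLinearMap.lsmul ℝ ℝ) hu
  have h := hprod.2 1 (right_mem_Icc.mpr zero_le_one)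
  simp only [ContinuousLinearMap.lsmul_apply, hzero 0 (by simp), hzero 1 (by simp), zero_smul,
    zero_add] at h
  rw [intervalIntegral_eq_setIntegral_Ioo] at h
  have e1 : ∫ ζ in Ioo (0 : ℝ) 1, deriv φ ζ • x ζ = ∫ ζ in Ioo (0 : ℝ) 1, deriv φ ζ • u ζ := by
    refine integral_congr_ae ?_
    filter_upwards [hx] with ζ hζ
    rw [hζ]
  have i1 : Integrable (fun ζ => deriv φ ζ • u ζ) unitIntervalMeasure := by
    refine (integrable_test_smul x hd h2.deriv).congr ?_
    filter_upwards [hx] with ζ hζ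
    rw [hζ]
  rw [integral_add (integrable_test_smul g h1.continuous h2) i1] at h
  rw [e1]
  exact (neg_eq_of_add_eq_zero_right h.symm).symm

/-- A test function of mean zero is the derivative of a test function: its primitive from `0`
vanishes to the right of the support because the total integral does. -/
theorem exists_test_primitive {θ : ℝ → ℝ} (hθ : ContDiff ℝ ∞ θ) {a b : ℝ} (ha : 0 < a) (hb : b < 1)
    (hsupp : Function.support θ ⊆ Icc a b) (hint : ∫ t, θ t = 0) :
    ∃ Φ : ℝ → ℝ, ContDiff ℝ ∞ Φ ∧ HasCompactSupport Φ ∧ tsupport Φ ⊆ Ioo 0 1 ∧ deriv Φ = θ := by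
  let Φ : ℝ → ℝ := fun t => ∫ s in (0 : ℝ)..t, θ s
  have hd : ∀ t, HasDerivAt Φ (θ t) t := fun t =>
    intervalIntegral.integral_hasDerivAt_right (hθ.continuous.intervalIntegrable _ _)
      (hθ.continuous.stronglyMeasurableAtFilter _ _) hθ.continuous.continuousAt
  have hderiv : deriv Φ = θ := funext fun t => (hd t).deriv
  have hΦ : Function.support Φ ⊆ Icc a b := by
    intro t ht
    by_contra hne
    refine ht ?_
    rw [mem_Icc, not_and_or, not_le, not_le] at hne
    rcases hne with hlt | hlt
    · refine (intervalIntegral.integral_congr (g := 0) fun s hs => ?_).trans (by simp)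
      by_contra hs0
      have h1 := (hsupp hs0).1
      have h2 : s ≤ max 0 t := hs.2
      rcases le_max_iff.mp h2 with h | h <;> linarith
    · refine (intervalIntegral.integral_eq_integral_of_support_subset fun s hs => ?_).trans hint
      exact ⟨ha.trans_le (hsupp hs).1, (hsupp hs).2.trans hlt.le⟩
  have htsupp : tsupport Φ ⊆ Icc a b := closure_minimal hΦ isClosed_Icc
  refine ⟨Φ, ?_, isCompact_Icc.of_isClosed_subset (isClosed_tsupport _) htsupp,
    htsupp.trans fun t ht => ⟨ha.trans_le ht.1, ht.2.trans_lt hb⟩, hderiv⟩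
  rw [contDiff_infty_iff_deriv, hderiv]
  exact ⟨fun t => (hd t).differentiableAt, hθ⟩

/-- The lemma of du Bois-Reymond. -/
theorem HasWeakDeriv.exists_ae_eq_const {z : StateSpace n} (hz : HasWeakDeriv z 0) :
    ∃ c : EuclideanSpace ℂ (Fin n), z =ᵐ[unitIntervalMeasure] fun _ => c := by
  let f : ContDiffBump (1 / 2 : ℝ) := ⟨1 / 8, 1 / 4, by norm_num, by norm_num⟩
  let ψ₀ : ℝ → ℝ := f.normed volume
  have hψ₀ : ContDiff ℝ ∞ ψ₀ := f.contDiff_normed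
  have hψ₀c : HasCompactSupport ψ₀ := f.hasCompactSupport_normed
  have hts : tsupport ψ₀ = Icc (1 / 4) (3 / 4) := by
    rw [f.tsupport_normed_eq, Real.closedBall_eq_Icc]; norm_num [f]
  have hψ₀1 : ∫ t, ψ₀ t = 1 := f.integral_normed
  -- The constant is forced by testing against the unit-mass bump `ψ₀`.
  set c : EuclideanSpace ℂ (Fin n) := ∫ ζ in Ioo (0 : ℝ) 1, ψ₀ ζ • z ζ with hc
  refine ⟨c, ?_⟩
  have hzero : ∀ φ : ℝ → ℝ, ContDiff ℝ ∞ φ → HasCompactSupport φ → tsupport φ ⊆ Ioo (0 : ℝ) 1 →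
      ∫ ζ in Ioo (0 : ℝ) 1, deriv φ ζ • z ζ = 0 := by
    intro φ h1 h2 h3
    rw [hz φ h1 h2 h3, neg_eq_zero,
      ← integral_zero ℝ (EuclideanSpace ℂ (Fin n)) (μ := unitIntervalMeasure)]
    refine integral_congr_ae ?_
    filter_upwards [Lp.coeFn_zero (EuclideanSpace ℂ (Fin n)) 2 unitIntervalMeasure] with ζ h
    rw [h, Pi.zero_apply, smul_zero]
  have hint : Integrable (fun ζ => z ζ - c) unitIntervalMeasure :=
    z.integrable.sub (integrable_const c)
  have key := isOpen_Ioo.ae_eq_zero_of_integral_contDiff_smul_eq_zero (U := Ioo (0 : ℝ) 1)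
    (f := fun ζ => z ζ - c) (μ := volume) (IntegrableOn.locallyIntegrableOn hint) (by
      intro ψ h1 h2 h3
      have hout : ∀ ζ, ζ ∉ Ioo (0 : ℝ) 1 → ψ ζ = 0 := fun ζ hζ => by
        by_contra hne
        exact hζ (h3 (subset_tsupport ψ hne))
      set m : ℝ := ∫ t, ψ t with hm
      -- Subtracting the multiple of `ψ₀` with the same mass leaves mean zero, so `θ` is the
      -- derivative of a test function.
      let θ : ℝ → ℝ := fun t => ψ t - m * ψ₀ t
      let K : Set ℝ := tsupport ψ ∪ Icc (1 / 4) (3 / 4)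
      have hK : IsCompact K := IsCompact.union h2 isCompact_Icc
      have hKne : K.Nonempty := ⟨1 / 2, Or.inr (by norm_num)⟩
      have hKsub : K ⊆ Ioo 0 1 := union_subset h3 fun t ht =>
        ⟨by linarith [ht.1], by linarith [ht.2]⟩
      obtain ⟨a, haK, ha⟩ := hK.exists_isLeast hKne
      obtain ⟨b, hbK, hb⟩ := hK.exists_isGreatest hKne
      have hsupp : Function.support θ ⊆ Icc a b := by
        intro t ht
        have htK : t ∈ K := by
          by_contra hne
          rw [mem_union, not_or, ← hts] at hne
          exact ht (by simp [θ, image_eq_zero_of_notMem_tsupport hne.1,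
            image_eq_zero_of_notMem_tsupport hne.2])
        exact ⟨ha htK, hb htK⟩
      have hψi : Integrable ψ := h1.continuous.integrable_of_hasCompactSupport h2
      have hψ₀i : Integrable ψ₀ := hψ₀.continuous.integrable_of_hasCompactSupport hψ₀c
      obtain ⟨Φ, hΦ, hΦc, hΦs, hΦd⟩ := exists_test_primitive (θ := θ)
        (h1.sub (contDiff_const.mul hψ₀)) (hKsub haK).1 (hKsub hbK).2 hsupp (by
          rw [integral_sub hψi (hψ₀i.const_mul m), integral_const_mul, hψ₀1, mul_one, sub_self])
      have h4 := hzero Φ hΦ hΦc hΦs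
      have i1 := integrable_test_smul z h1.continuous h2
      have i2 := integrable_test_smul z hψ₀.continuous hψ₀c
      have h5 : ∫ ζ in Ioo (0 : ℝ) 1, ψ ζ • z ζ = m • c := by
        rw [hc, ← integral_smul, ← sub_eq_zero, ← integral_sub i1 (i2.fun_smul m), ← h4, hΦd]
        refine integral_congr_ae (.of_forall fun ζ => ?_)
        simp only [θ, smul_smul, sub_smul]
      have h6 : ∫ ζ in Ioo (0 : ℝ) 1, ψ ζ = m :=
        setIntegral_eq_integral_of_forall_compl_eq_zero hout
      rw [← setIntegral_eq_integral_of_forall_compl_eq_zero (s := Ioo (0 : ℝ) 1)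
        fun ζ hζ => by rw [hout ζ hζ, zero_smul]]
      simp only [smul_sub]
      rw [integral_sub i1 (hψi.restrict.smul_const c), h5, integral_smul_const, h6, sub_self])
  filter_upwards [(ae_restrict_iff' measurableSet_Ioo).mpr key] with ζ hζ
  exact sub_eq_zero.mp hζ

theorem memLp_of_continuousOn_Icc {V : Type*} [NormedAddCommGroup V] {u : ℝ → V}
    (hu : ContinuousOn u (Icc 0 1)) :
    MemLp u 2 unitIntervalMeasure := by
  obtain ⟨M, hM⟩ := isCompact_Icc.exists_bound_of_continuousOn hu
  refine MemLp.of_bound ((hu.mono Ioo_subset_Icc_self).aestronglyMeasurable measurableSet_Ioo) M ?_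
  filter_upwards [ae_restrict_mem measurableSet_Ioo] with t ht
  exact hM t (Ioo_subset_Icc_self ht)

/-- The difference of `x` and the integral of `g` has weak derivative zero, so it is constant by du
Bois-Reymond. -/
theorem HasWeakDeriv.exists_isPrimitive {x g : StateSpace n} (h : HasWeakDeriv x g) :
    ∃ u : ℝ → EuclideanSpace ℂ (Fin n), IsPrimitive u g ∧ x =ᵐ[unitIntervalMeasure] u := by
  let U : ℝ → EuclideanSpace ℂ (Fin n) := fun t => ∫ s in (0 : ℝ)..t, g s
  have hU : IsPrimitive U g := ⟨g.intervalIntegrable, fun t _ => by simp [U]⟩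
  have hUm := memLp_of_continuousOn_Icc hU.continuousOn
  have hy : HasWeakDeriv hUm.toLp g := hasWeakDeriv_of_isPrimitive hU hUm.coeFn_toLp
  have hz : HasWeakDeriv (x + (-1 : ℂ) • hUm.toLp) 0 := by
    have := h.add (hy.smul (-1))
    rwa [neg_one_smul ℂ g, add_neg_cancel] at this
  obtain ⟨c, hc⟩ := hz.exists_ae_eq_const
  refine ⟨fun t => c + U t, ?_, ?_⟩
  · have := (isPrimitive_const c).add hU
    simpa using this
  · filter_upwards [hc, Lp.coeFn_add x ((-1 : ℂ) • hUm.toLp), Lp.coeFn_smul (-1 : ℂ) hUm.toLp,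
      hUm.coeFn_toLp] with t h1 h2 h3 h4
    rw [← h1, h2, Pi.add_apply, h3, Pi.smul_apply, h4, neg_one_smul, neg_add_cancel_right]

theorem eqOn_Icc_of_ae_eq_unitInterval {V : Type*} [NormedAddCommGroup V] {u v : ℝ → V}
    (hu : ContinuousOn u (Icc 0 1)) (hv : ContinuousOn v (Icc 0 1))
    (h : u =ᵐ[unitIntervalMeasure] v) : EqOn u v (Icc 0 1) := by
  refine Measure.eqOn_Icc_of_ae_eq volume zero_ne_one ?_ hu hv
  rwa [Measure.restrict_congr_set Ioo_ae_eq_Icc.symm]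

theorem HasWeakDeriv.unique {x g g' : StateSpace n} (h : HasWeakDeriv x g)
    (h' : HasWeakDeriv x g') : g = g' := by
  have h0 := h.add (h'.smul (-1))
  rw [neg_one_smul ℂ x, neg_one_smul ℂ g', add_neg_cancel] at h0
  exact add_neg_eq_zero.mp h0.eq_zero

theorem exists_weakDeriv_eq {x g : StateSpace n} (h : HasWeakDeriv x g) :
    ∃ hx : x ∈ (weakDeriv n).domain, weakDeriv n ⟨x, hx⟩ = g := by
  have hx : x ∈ (weakDeriv n).domain := ⟨(x, g), h, rfl⟩
  exact ⟨hx, (hasWeakDeriv_weakDeriv ⟨x, hx⟩).unique h⟩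

variable (P₁ P₀ : Matrix (Fin n) (Fin n) ℂ) (W : Matrix (Fin n) (Fin n ⊕ Fin n) ℂ)

/-- The continuous representative in the domain agrees on all of `[0,1]` with the primitive of the
weak derivative, so the boundary condition passes to the latter. -/
theorem portOperator_exists_isPrimitive (x : (portOperator P₁ P₀ W).domain) :
    ∃ (u : ℝ → EuclideanSpace ℂ (Fin n)) (g : StateSpace n), IsPrimitive u g ∧
      (x : StateSpace n) =ᵐ[unitIntervalMeasure] u ∧
      W *ᵥ Sum.elim (u 1).ofLp (u 0).ofLp = 0 ∧
      portOperator P₁ P₀ W x = constMul P₁ g + constMul P₀ x := by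
  obtain ⟨x, hx, v, hv, hxv, hW⟩ := x
  have hg := hasWeakDeriv_weakDeriv ⟨x, hx⟩
  obtain ⟨u, hu, hxu⟩ := hg.exists_isPrimitive
  have heq := eqOn_Icc_of_ae_eq_unitInterval hu.continuousOn hv (hxu.symm.trans hxv)
  refine ⟨u, _, hu, hxu, ?_, rfl⟩
  rw [heq (right_mem_Icc.mpr zero_le_one), heq (left_mem_Icc.mpr zero_le_one), hW]

theorem portOperator_exists_of_isPrimitive {u : ℝ → EuclideanSpace ℂ (Fin n)} {x g : StateSpace n}
    (hu : IsPrimitive u g) (hxu : x =ᵐ[unitIntervalMeasure] u)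
    (hW : W *ᵥ Sum.elim (u 1).ofLp (u 0).ofLp = 0) :
    ∃ z : (portOperator P₁ P₀ W).domain, (z : StateSpace n) = x ∧
      portOperator P₁ P₀ W z = constMul P₁ g + constMul P₀ x := by
  obtain ⟨hx, hxg⟩ := exists_weakDeriv_eq (hasWeakDeriv_of_isPrimitive hu hxu)
  exact ⟨⟨x, hx, u, hu.continuousOn, hxu, hW⟩, rfl,
    congrArg (fun y => constMul P₁ y + constMul P₀ x) hxg⟩

end WeakDerivative

/-! ### The energy balance -/

section EnergyBalance

variable {n : ℕ}

/-- The real bilinear form `(a, b) ↦ Re ⟨M a, b⟩`. -/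
noncomputable def reForm (M : Matrix (Fin n) (Fin n) ℂ) :
    EuclideanSpace ℂ (Fin n) →L[ℝ] EuclideanSpace ℂ (Fin n) →L[ℝ] ℝ :=
  LinearMap.mkContinuous₂ (LinearMap.mk₂ ℝ
    (fun a b => (inner ℂ (Matrix.toEuclideanCLM (n := Fin n) (𝕜 := ℂ) M a) b).re)
    (fun a a' b => by rw [map_add, inner_add_left, Complex.add_re])
    (fun c a b => by
      rw [ContinuousLinearMap.map_smul_of_tower, inner_smul_left_eq_smul]; simp)
    (fun a b b' => by rw [inner_add_right, Complex.add_re])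
    (fun c a b => by rw [inner_smul_right_eq_smul]; simp))
    ‖Matrix.toEuclideanCLM (n := Fin n) (𝕜 := ℂ) M‖ fun a b =>
      (Complex.abs_re_le_norm _).trans ((norm_inner_le_norm _ _).trans
        (mul_le_mul_of_nonneg_right (ContinuousLinearMap.le_opNorm _ _) (norm_nonneg _)))

theorem reForm_apply (M : Matrix (Fin n) (Fin n) ℂ) (a b : EuclideanSpace ℂ (Fin n)) :
    reForm M a b = (inner ℂ (Matrix.toEuclideanCLM (n := Fin n) (𝕜 := ℂ) M a) b).re := rfl

theorem inner_toEuclideanCLM_left (M : Matrix (Fin n) (Fin n) ℂ)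
    (a b : EuclideanSpace ℂ (Fin n)) :
    inner ℂ (Matrix.toEuclideanCLM (n := Fin n) (𝕜 := ℂ) M a) b
      = inner ℂ a (Matrix.toEuclideanCLM (n := Fin n) (𝕜 := ℂ) Mᴴ b) := by
  rw [← Matrix.star_eq_conjTranspose, map_star, ContinuousLinearMap.star_eq_adjoint,
    ContinuousLinearMap.adjoint_inner_right]

theorem reForm_comm {M : Matrix (Fin n) (Fin n) ℂ} (hM : M.IsHermitian)
    (a b : EuclideanSpace ℂ (Fin n)) : reForm M a b = reForm M b a := by
  rw [reForm_apply, reForm_apply, inner_toEuclideanCLM_left, hM.eq, re_inner_comm]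

theorem reForm_self_eq (M : Matrix (Fin n) (Fin n) ℂ) (a : EuclideanSpace ℂ (Fin n)) :
    reForm M a a = (star a.ofLp ⬝ᵥ (M *ᵥ a.ofLp)).re := by
  rw [reForm_apply, re_inner_comm, EnergySpace.inner_eq_dotProduct]

theorem coeFn_constMul (M : Matrix (Fin n) (Fin n) ℂ) (x : StateSpace n) :
    constMul M x =ᵐ[unitIntervalMeasure]
      fun ζ => Matrix.toEuclideanCLM (n := Fin n) (𝕜 := ℂ) M (x ζ) :=
  ContinuousLinearMap.coeFn_compLpL _ _

theorem re_inner_constMul (M : Matrix (Fin n) (Fin n) ℂ) (x y : StateSpace n) :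
    (inner ℂ (constMul M x) y).re = ∫ ζ in Ioo (0 : ℝ) 1, reForm M (x ζ) (y ζ) := by
  rw [L2.inner_def]
  change Complex.reCLM _ = _
  rw [← Complex.reCLM.integral_comp_comm (L2.integrable_inner _ _)]
  refine integral_congr_ae ?_
  filter_upwards [coeFn_constMul M x] with ζ h
  rw [h]
  rfl

/-- The energy balance: integrate the derivative of `Re⟨Mu, u⟩`, whose two product-rule terms
coincide because `M` is Hermitian. -/
theorem two_mul_re_inner_constMul_deriv {M : Matrix (Fin n) (Fin n) ℂ} (hM : M.IsHermitian)
    {u : ℝ → EuclideanSpace ℂ (Fin n)} {x g : StateSpace n} (hu : IsPrimitive u g)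
    (hx : x =ᵐ[unitIntervalMeasure] u) :
    2 * (inner ℂ (constMul M g) x).re = reForm M (u 1) (u 1) - reForm M (u 0) (u 0) := by
  have h := (hu.bilinear (reForm M) hu).2 1 (right_mem_Icc.mpr zero_le_one)
  rw [h, add_sub_cancel_left, re_inner_constMul, intervalIntegral_eq_setIntegral_Ioo,
    ← integral_const_mul]
  refine integral_congr_ae ?_
  filter_upwards [hx] with ζ hζ
  rw [hζ, reForm_comm hM (u ζ) (g ζ), two_mul]

theorem re_dotProduct_hermitianPart (M : Matrix (Fin n) (Fin n) ℂ) (v : Fin n → ℂ) :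
    (star v ⬝ᵥ (hermitianPart M *ᵥ v)) = ((star v ⬝ᵥ (M *ᵥ v)).re : ℂ) := by
  have h1 : star v ⬝ᵥ (Mᴴ *ᵥ v) = star (star v ⬝ᵥ (M *ᵥ v)) := by
    rw [Matrix.star_dotProduct, Matrix.star_mulVec, Matrix.conjTranspose_conjTranspose,
      ← Matrix.dotProduct_mulVec]
  rw [hermitianPart, Matrix.smul_mulVec, Matrix.add_mulVec, dotProduct_smul, dotProduct_add, h1]
  apply Complex.ext <;> simp
  ring

theorem hermitianPart_isHermitian (M : Matrix (Fin n) (Fin n) ℂ) :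
    (hermitianPart M).IsHermitian := by
  rw [hermitianPart, Matrix.IsHermitian, Matrix.conjTranspose_smul, Matrix.conjTranspose_add,
    Matrix.conjTranspose_conjTranspose, add_comm]
  simp

theorem posSemidef_neg_hermitianPart_iff (M : Matrix (Fin n) (Fin n) ℂ) :
    (-hermitianPart M).PosSemidef ↔ ∀ v : EuclideanSpace ℂ (Fin n), reForm M v v ≤ 0 := by
  rw [Matrix.posSemidef_iff_dotProduct_mulVec]
  constructor
  · rintro ⟨-, h⟩ v
    have := h v.ofLp
    rw [Matrix.neg_mulVec, dotProduct_neg, re_dotProduct_hermitianPart, ← reForm_self_eq,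
      ← Complex.ofReal_neg, Complex.zero_le_real] at this
    linarith
  · intro h
    refine ⟨(hermitianPart_isHermitian M).neg, fun v => ?_⟩
    have := h (WithLp.toLp 2 v)
    rw [reForm_self_eq] at this
    rw [Matrix.neg_mulVec, dotProduct_neg, re_dotProduct_hermitianPart,
      ← Complex.ofReal_neg, Complex.zero_le_real]
    simp only at this
    linarith

theorem dotProduct_mulVec_self_eq_re {M : Matrix (Fin n) (Fin n) ℂ} (hM : M.IsHermitian)
    (v : Fin n → ℂ) : star v ⬝ᵥ (M *ᵥ v) = ((star v ⬝ᵥ (M *ᵥ v)).re : ℂ) := by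
  rw [← re_dotProduct_hermitianPart, hermitianPart, hM.eq, ← two_smul ℂ M, smul_smul]
  simp

/-- In the order of `ℂ`, being `≤ 0` includes having zero imaginary part; that is automatic for
Hermitian `M`. -/
theorem dotProduct_sub_nonpos_iff {M : Matrix (Fin n) (Fin n) ℂ} (hM : M.IsHermitian)
    (u y : Fin n → ℂ) : star u ⬝ᵥ (M *ᵥ u) - star y ⬝ᵥ (M *ᵥ y) ≤ 0 ↔
      (star u ⬝ᵥ (M *ᵥ u)).re - (star y ⬝ᵥ (M *ᵥ y)).re ≤ 0 := by
  rw [dotProduct_mulVec_self_eq_re hM u, dotProduct_mulVec_self_eq_re hM y, ← Complex.ofReal_sub,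
    ← Complex.ofReal_zero, Complex.real_le_real]
  simp

variable {P₁ P₀ : Matrix (Fin n) (Fin n) ℂ} {W : Matrix (Fin n) (Fin n ⊕ Fin n) ℂ}

theorem portOperator_dissipative (hP₁ : P₁.IsHermitian) (hP₀ : (-hermitianPart P₀).PosSemidef)
    (hW : ∀ u y : Fin n → ℂ, W *ᵥ Sum.elim u y = 0 →
      star u ⬝ᵥ (P₁ *ᵥ u) - star y ⬝ᵥ (P₁ *ᵥ y) ≤ 0) (x : (portOperator P₁ P₀ W).domain) :
    (inner ℂ (portOperator P₁ P₀ W x) (x : StateSpace n)).re ≤ 0 := by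
  obtain ⟨u, g, hu, hxu, hbc, hAx⟩ := portOperator_exists_isPrimitive P₁ P₀ W x
  rw [hAx, inner_add_left, Complex.add_re]
  have h1 := two_mul_re_inner_constMul_deriv hP₁ hu hxu
  have h2 := (dotProduct_sub_nonpos_iff hP₁ _ _).mp (hW _ _ hbc)
  rw [← reForm_self_eq, ← reForm_self_eq] at h2
  have h3 : (inner ℂ (constMul P₀ (x : StateSpace n)) (x : StateSpace n)).re ≤ 0 := by
    rw [re_inner_constMul]
    exact integral_nonpos fun ζ => (posSemidef_neg_hermitianPart_iff P₀).mp hP₀ _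
  linarith

end EnergyBalance

/-! ### Necessity of the matrix conditions: testing with explicit functions -/

section Necessity

variable {n : ℕ} {P₁ P₀ : Matrix (Fin n) (Fin n) ℂ} {W : Matrix (Fin n) (Fin n ⊕ Fin n) ℂ}

theorem IsPrimitive.congr_ae {V : Type*} [NormedAddCommGroup V] [NormedSpace ℝ V] {u g g' : ℝ → V}
    (h : IsPrimitive u g) (hg : g =ᵐ[unitIntervalMeasure] g') : IsPrimitive u g' := by
  refine ⟨intervalIntegrable_iff_integrable_unitInterval.mpr
    ((intervalIntegrable_iff_integrable_unitInterval.mp h.1).congr hg), fun t ht => ?_⟩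
  rw [h.2 t ht, intervalIntegral.integral_of_le ht.1, intervalIntegral.integral_of_le ht.1,
    integral_Ioc_eq_integral_Ioo, integral_Ioc_eq_integral_Ioo]
  congr 1
  exact integral_congr_ae (ae_restrict_of_ae_restrict_of_subset (Ioo_subset_Ioo_right ht.2) hg)

theorem half_reForm_add_integral_nonpos (hP₁ : P₁.IsHermitian)
    (hdis : ∀ x : (portOperator P₁ P₀ W).domain,
      (inner ℂ (portOperator P₁ P₀ W x) (x : StateSpace n)).re ≤ 0)
    {u g : ℝ → EuclideanSpace ℂ (Fin n)} (hu : ∀ t, HasDerivAt u (g t) t) (hg : Continuous g)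
    (hW : W *ᵥ Sum.elim (u 1).ofLp (u 0).ofLp = 0) :
    (reForm P₁ (u 1) (u 1) - reForm P₁ (u 0) (u 0)) / 2
      + ∫ t in Ioo (0 : ℝ) 1, reForm P₀ (u t) (u t) ≤ 0 := by
  have huc : Continuous u := continuous_iff_continuousAt.mpr fun t => (hu t).continuousAt
  have hum := memLp_of_continuousOn_Icc huc.continuousOn
  have hgm := memLp_of_continuousOn_Icc hg.continuousOn
  have hprim : IsPrimitive u hgm.toLp :=
    (isPrimitive_of_hasDerivAt hu hg).congr_ae hgm.coeFn_toLp.symm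
  obtain ⟨z, hz, hAz⟩ := portOperator_exists_of_isPrimitive P₁ P₀ W hprim hum.coeFn_toLp hW
  have h := hdis z
  have h1 := two_mul_re_inner_constMul_deriv hP₁ hprim hum.coeFn_toLp
  rw [hAz, hz, inner_add_left, Complex.add_re, re_inner_constMul P₀] at h
  have h2 : ∫ ζ in Ioo (0 : ℝ) 1, reForm P₀ ((hum.toLp : StateSpace n) ζ)
        ((hum.toLp : StateSpace n) ζ)
      = ∫ t in Ioo (0 : ℝ) 1, reForm P₀ (u t) (u t) := by
    refine integral_congr_ae ?_
    filter_upwards [hum.coeFn_toLp] with t ht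
    rw [ht]
  linarith

/-- The profile `t(1-t)v` satisfies every boundary condition and has no boundary energy; what
remains is `Re⟨P₀v, v⟩` times the positive integral of `t²(1-t)²`. -/
theorem posSemidef_neg_hermitianPart_of_dissipative (hP₁ : P₁.IsHermitian)
    (hdis : ∀ x : (portOperator P₁ P₀ W).domain,
      (inner ℂ (portOperator P₁ P₀ W x) (x : StateSpace n)).re ≤ 0) :
    (-hermitianPart P₀).PosSemidef := by
  rw [posSemidef_neg_hermitianPart_iff]
  intro v
  have hu : ∀ t : ℝ, HasDerivAt (fun t : ℝ => (t * (1 - t)) • v) ((1 - 2 * t) • v) t := fun t => by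
    have h := ((hasDerivAt_id t).mul ((hasDerivAt_id t).const_sub 1)).smul_const v
    refine h.congr_deriv ?_
    simp only [id]
    congr 1
    ring
  have h := half_reForm_add_integral_nonpos hP₁ hdis hu (by fun_prop) (by
    have : Sum.elim (((1 : ℝ) * (1 - 1)) • v).ofLp (((0 : ℝ) * (1 - 0)) • v).ofLp = 0 := by
      ext i; cases i <;> simp
    rw [this, Matrix.mulVec_zero])
  simp only [map_smul, smul_apply, smul_eq_mul, ← mul_assoc, integral_mul_const] at h
  have hpos : 0 < ∫ t in Ioo (0 : ℝ) 1, t * (1 - t) * t * (1 - t) := by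
    rw [← intervalIntegral_eq_setIntegral_Ioo]
    refine intervalIntegral.intervalIntegral_pos_of_pos_on
      (Continuous.intervalIntegrable (by fun_prop) _ _) (fun t ht => ?_) one_pos
    have h1 := sub_pos.mpr ht.2
    have h0 := ht.1
    positivity
  norm_num at h
  exact nonpos_of_mul_nonpos_right h hpos

theorem boundary_form_nonpos_of_dissipative (hP₁ : P₁.IsHermitian)
    (hdis : ∀ x : (portOperator P₁ P₀ W).domain,
      (inner ℂ (portOperator P₁ P₀ W x) (x : StateSpace n)).re ≤ 0)
    (u y : Fin n → ℂ) (hW : W *ᵥ Sum.elim u y = 0) :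
    star u ⬝ᵥ (P₁ *ᵥ u) - star y ⬝ᵥ (P₁ *ᵥ y) ≤ 0 := by
  rw [dotProduct_sub_nonpos_iff hP₁]
  set a : EuclideanSpace ℂ (Fin n) := WithLp.toLp 2 u with ha
  set b : EuclideanSpace ℂ (Fin n) := WithLp.toLp 2 y with hb
  change (star a.ofLp ⬝ᵥ (P₁ *ᵥ a.ofLp)).re - (star b.ofLp ⬝ᵥ (P₁ *ᵥ b.ofLp)).re ≤ 0
  rw [← reForm_self_eq, ← reForm_self_eq]
  -- These functions keep the end values `a` and `b` but tend boundedly to `0` inside, so the `P₀`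
  -- term disappears in the limit. The exponent `k + 1` makes the end values right for `k = 0` as
  -- well.
  let f : ℕ → ℝ → EuclideanSpace ℂ (Fin n) := fun k t => t ^ (k + 1) • a + (1 - t) ^ (k + 1) • b
  let g : ℕ → ℝ → EuclideanSpace ℂ (Fin n) := fun k t =>
    ((k + 1) * t ^ k) • a + (-((k + 1) * (1 - t) ^ k)) • b
  have hfg : ∀ k t, HasDerivAt (f k) (g k t) t := fun k t => by
    have h1 := (hasDerivAt_pow (k + 1) t).smul_const a
    have h2 := (((hasDerivAt_id t).const_sub 1).pow (k + 1)).smul_const b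
    refine (h1.add h2).congr_deriv ?_
    simp [g]
  have hf1 : ∀ k, f k 1 = a := fun k => by simp [f]
  have hf0 : ∀ k, f k 0 = b := fun k => by simp [f]
  have hle : ∀ k, (reForm P₁ a a - reForm P₁ b b) / 2
      + ∫ t in Ioo (0 : ℝ) 1, reForm P₀ (f k t) (f k t) ≤ 0 := fun k => by
    have h := half_reForm_add_integral_nonpos hP₁ hdis (hfg k)
      (by simp only [g]; fun_prop) (by rw [hf1, hf0]; exact hW)
    rwa [hf1, hf0] at h
  have hfcont : ∀ k, Continuous (f k) := fun k => by simp only [f]; fun_prop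
  have hlim : Tendsto (fun k => ∫ t in Ioo (0 : ℝ) 1, reForm P₀ (f k t) (f k t)) atTop (𝓝 0) := by
    suffices h : Tendsto (fun k => ∫ t in Ioo (0 : ℝ) 1, reForm P₀ (f k t) (f k t)) atTop
        (𝓝 (∫ _ in Ioo (0 : ℝ) 1, (0 : ℝ))) by rwa [integral_zero] at h
    refine tendsto_integral_of_dominated_convergence (μ := unitIntervalMeasure)
      (fun _ => ‖reForm P₀‖ * (‖a‖ + ‖b‖) * (‖a‖ + ‖b‖)) (fun k => ?_) (integrable_const _)
      (fun k => ?_) ?_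
    · have : Continuous fun t => reForm P₀ (f k t) (f k t) :=
        ((reForm P₀).continuous.comp (hfcont k)).clm_apply (hfcont k)
      exact this.aestronglyMeasurable
    · filter_upwards [ae_restrict_mem measurableSet_Ioo] with t ht
      have hb' : ‖f k t‖ ≤ ‖a‖ + ‖b‖ := by
        refine (norm_add_le _ _).trans (add_le_add ?_ ?_)
        · rw [norm_smul, Real.norm_eq_abs, abs_of_nonneg (pow_nonneg ht.1.le _)]
          exact mul_le_of_le_one_left (norm_nonneg _) (pow_le_one₀ ht.1.le ht.2.le)
        · have := sub_nonneg.mpr ht.2.le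
          rw [norm_smul, Real.norm_eq_abs, abs_of_nonneg (pow_nonneg this _)]
          exact mul_le_of_le_one_left (norm_nonneg _) (pow_le_one₀ this (by linarith [ht.1]))
      refine ((reForm P₀).le_opNorm₂ _ _).trans ?_
      gcongr
    · filter_upwards [ae_restrict_mem measurableSet_Ioo] with t ht
      have h1 : Tendsto (fun k : ℕ => t ^ (k + 1)) atTop (𝓝 0) :=
        (tendsto_pow_atTop_nhds_zero_of_lt_one ht.1.le ht.2).comp (tendsto_add_atTop_nat 1)
      have h2 : Tendsto (fun k : ℕ => (1 - t) ^ (k + 1)) atTop (𝓝 0) :=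
        (tendsto_pow_atTop_nhds_zero_of_lt_one (sub_nonneg.mpr ht.2.le)
          (by linarith [ht.1])).comp (tendsto_add_atTop_nat 1)
      have h3 : Tendsto (fun k => f k t) atTop (𝓝 0) := by
        simpa using (h1.smul_const a).add (h2.smul_const b)
      have hcont : Continuous fun v => reForm P₀ v v :=
        (reForm P₀).continuous.clm_apply continuous_id
      have h4 := (hcont.tendsto 0).comp h3
      simpa [Function.comp_def] using h4
  have h := le_of_tendsto' (hlim.const_add ((reForm P₁ a a - reForm P₁ b b) / 2)) hle
  linarith

end Necessity

/-! ### Maximal semidefinite subspaces of the swap form -/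

/-- The heterogeneous product of matrices may elaborate to the product of `CStarMatrix`. -/
theorem cstarMatrix_hMul_eq {l m n A : Type*} [Fintype m] [Mul A] [AddCommMonoid A]
    (M : Matrix l m A) (N : Matrix m n A) :
    @HMul.hMul (Matrix l m A) (Matrix m n A) (Matrix l n A)
        CStarMatrix.instHMulOfFintypeOfMulOfAddCommMonoid M N
      = @HMul.hMul (Matrix l m A) (Matrix m n A) (Matrix l n A)
        Matrix.instHMulOfFintypeOfMulOfAddCommMonoid M N := rfl

section SwapForm

variable {n : ℕ}

theorem swapMatrix_isHermitian : (swapMatrix n).IsHermitian := by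
  rw [Matrix.IsHermitian, swapMatrix, Matrix.fromBlocks_conjTranspose]
  simp

theorem swapMatrix_mul_self : swapMatrix n * swapMatrix n = 1 := by
  rw [swapMatrix, Matrix.fromBlocks_multiply]
  simp [Matrix.fromBlocks_one]

/-- The quadratic form `f* Σ f` of the swap matrix. -/
noncomputable def swapForm (f : Fin n ⊕ Fin n → ℂ) : ℝ := (star f ⬝ᵥ (swapMatrix n *ᵥ f)).re

theorem star_dotProduct_swapMatrix_mulVec_comm (f g : Fin n ⊕ Fin n → ℂ) :
    star f ⬝ᵥ (swapMatrix n *ᵥ g) = star (star g ⬝ᵥ (swapMatrix n *ᵥ f)) := by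
  rw [Matrix.star_dotProduct, Matrix.star_mulVec, swapMatrix_isHermitian.eq,
    ← Matrix.dotProduct_mulVec]

theorem swapForm_add_smul {f g : Fin n ⊕ Fin n → ℂ} (h : star f ⬝ᵥ (swapMatrix n *ᵥ g) = 0)
    (c : ℂ) : swapForm (f + c • g) = swapForm f + Complex.normSq c * swapForm g := by
  have h' : star g ⬝ᵥ (swapMatrix n *ᵥ f) = 0 := by
    rw [star_dotProduct_swapMatrix_mulVec_comm, h, star_zero]
  have h2 : star (f + c • g) ⬝ᵥ (swapMatrix n *ᵥ (f + c • g))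
      = star f ⬝ᵥ (swapMatrix n *ᵥ f)
        + (Complex.normSq c : ℂ) * (star g ⬝ᵥ (swapMatrix n *ᵥ g)) := by
    rw [star_add, star_smul, Matrix.mulVec_add, Matrix.mulVec_smul, add_dotProduct,
      dotProduct_add, dotProduct_add, smul_dotProduct, smul_dotProduct, dotProduct_smul,
      dotProduct_smul, h, h', Complex.normSq_eq_conj_mul_self]
    simp [mul_assoc]
  rw [swapForm, h2, Complex.add_re, Complex.re_ofReal_mul]
  rfl

theorem swapForm_elim_smul (s : ℝ) (a : Fin n → ℂ) :
    swapForm (Sum.elim a ((s : ℂ) • a)) = 2 * s * (star a ⬝ᵥ a).re := by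
  have h : star (Sum.elim a ((s : ℂ) • a)) = Sum.elim (star a) ((s : ℂ) • star a) := by
    ext i; cases i <;> simp
  rw [swapForm, swapMatrix, Matrix.fromBlocks_mulVec, h]
  simp only [Function.comp_def, Sum.elim_inl, Sum.elim_inr, Matrix.zero_mulVec, Matrix.one_mulVec,
    zero_add, add_zero, sumElim_dotProduct_sumElim]
  rw [show (fun i => ((s : ℂ) • a) i) = (s : ℂ) • a from rfl, smul_dotProduct, dotProduct_smul]
  simp
  ring

/-- A subspace on which the swap form has a sign has dimension at most `n`. -/
theorem finrank_le_of_swapForm_nonpos {s : ℝ} (hs : s * s = 1)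
    (N : Submodule ℂ (Fin n ⊕ Fin n → ℂ)) (hN : ∀ f ∈ N, s * swapForm f ≤ 0) :
    Module.finrank ℂ N ≤ n := by
  -- The graph of `s • id` has dimension `n`, and `s` times the form is positive definite on it, so
  -- it meets `N` only in `0`.
  let L : (Fin n → ℂ) →ₗ[ℂ] (Fin n ⊕ Fin n → ℂ) :=
    { toFun := fun a => Sum.elim a ((s : ℂ) • a)
      map_add' := fun a b => by ext i; cases i <;> simp
      map_smul' := fun c a => by ext i; cases i <;> simp [mul_left_comm] }
  have hinj : Function.Injective L := fun a b hab => by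
    ext i
    exact congrFun hab (Sum.inl i)
  have hrank : Module.finrank ℂ L.range = n := by
    rw [LinearMap.finrank_range_of_inj hinj, Module.finrank_fin_fun]
  have hdisj : Disjoint N L.range := by
    rw [Submodule.disjoint_def]
    rintro _ hf ⟨a, rfl⟩
    have h := hN _ hf
    change s * swapForm (Sum.elim a ((s : ℂ) • a)) ≤ 0 at h
    rw [swapForm_elim_smul] at h
    have h1 : (star a ⬝ᵥ a).re ≤ 0 := by
      have : s * (2 * s * (star a ⬝ᵥ a).re) = 2 * (star a ⬝ᵥ a).re := by
        linear_combination (2 * (star a ⬝ᵥ a).re) * hs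
      linarith
    have h2 := Complex.nonneg_iff.mp (dotProduct_star_self_nonneg a)
    have h3 : star a ⬝ᵥ a = 0 := Complex.ext (le_antisymm h1 h2.1) h2.2.symm
    rw [dotProduct_star_self_eq_zero.mp h3, map_zero]
  have h := Submodule.finrank_add_finrank_le_of_disjoint hdisj
  rw [hrank, Module.finrank_fintype_fun_eq_card, Fintype.card_sum, Fintype.card_fin] at h
  omega

/-- If `s * swapForm g` were negative, adjoining `g` to `N` would preserve the sign condition; the
dimension bound then puts `g` in `N`, so `g` is orthogonal to itself and its form vanishes. The sign
`s = ±1` treats both kinds of maximal subspace. -/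
theorem swapForm_nonneg_of_orthogonal {s : ℝ} (hs : s * s = 1)
    {N : Submodule ℂ (Fin n ⊕ Fin n → ℂ)} (hN : ∀ f ∈ N, s * swapForm f ≤ 0)
    (hrank : Module.finrank ℂ N = n) {g : Fin n ⊕ Fin n → ℂ}
    (hg : ∀ f ∈ N, star f ⬝ᵥ (swapMatrix n *ᵥ g) = 0) : 0 ≤ s * swapForm g := by
  by_contra! hneg
  have hle := finrank_le_of_swapForm_nonpos hs (N ⊔ Submodule.span ℂ {g}) (fun f hf => by
    obtain ⟨f', hf', g', hg', rfl⟩ := Submodule.mem_sup.mp hf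
    obtain ⟨c, rfl⟩ := Submodule.mem_span_singleton.mp hg'
    rw [swapForm_add_smul (hg f' hf')]
    have := mul_nonpos_of_nonneg_of_nonpos (Complex.normSq_nonneg c) hneg.le
    linarith [hN f' hf'])
  have heq := Submodule.eq_of_le_of_finrank_le (le_sup_left : N ≤ N ⊔ Submodule.span ℂ {g})
    (by rwa [hrank])
  have hmem : g ∈ N := by
    rw [heq]
    exact Submodule.mem_sup_right (Submodule.mem_span_singleton_self g)
  have h0 : swapForm g = 0 := by rw [swapForm, hg g hmem, Complex.zero_re]
  rw [h0, mul_zero] at hneg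
  exact lt_irrefl _ hneg

variable (V : Matrix (Fin n) (Fin n ⊕ Fin n) ℂ)

theorem finrank_ker_add_rank : Module.finrank ℂ (LinearMap.ker V.mulVecLin) + V.rank = n + n := by
  have h := LinearMap.finrank_range_add_finrank_ker V.mulVecLin
  rw [Module.finrank_fintype_fun_eq_card, Fintype.card_sum, Fintype.card_fin] at h
  rw [add_comm]
  exact h

theorem star_dotProduct_conjTranspose_mulVec (f : Fin n ⊕ Fin n → ℂ) (v : Fin n → ℂ) :
    star f ⬝ᵥ (Vᴴ *ᵥ v) = star (V *ᵥ f) ⬝ᵥ v := by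
  rw [Matrix.star_mulVec, Matrix.dotProduct_mulVec]

theorem swapMatrix_mulVec_swapMatrix_mulVec (f : Fin n ⊕ Fin n → ℂ) :
    swapMatrix n *ᵥ (swapMatrix n *ᵥ f) = f := by
  rw [Matrix.mulVec_mulVec, swapMatrix_mul_self, Matrix.one_mulVec]

theorem star_dotProduct_mul_swapMatrix_mul (v : Fin n → ℂ) :
    star v ⬝ᵥ ((V * swapMatrix n * Vᴴ) *ᵥ v)
      = star (swapMatrix n *ᵥ (Vᴴ *ᵥ v)) ⬝ᵥ (swapMatrix n *ᵥ (swapMatrix n *ᵥ (Vᴴ *ᵥ v))) := by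
  rw [swapMatrix_mulVec_swapMatrix_mulVec, Matrix.star_mulVec, swapMatrix_isHermitian.eq,
    ← Matrix.dotProduct_mulVec, Matrix.star_mulVec, Matrix.conjTranspose_conjTranspose,
    ← Matrix.dotProduct_mulVec]
  simp only [Matrix.mulVec_mulVec, Matrix.mul_assoc]

theorem mul_swapMatrix_mul_isHermitian : (V * swapMatrix n * Vᴴ).IsHermitian :=
  Matrix.isHermitian_mul_mul_conjTranspose V swapMatrix_isHermitian

theorem posSemidef_mul_swapMatrix_mul_iff : (V * swapMatrix n * Vᴴ).PosSemidef ↔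
    ∀ v, 0 ≤ swapForm (swapMatrix n *ᵥ (Vᴴ *ᵥ v)) := by
  rw [Matrix.posSemidef_iff_dotProduct_mulVec, and_iff_right (mul_swapMatrix_mul_isHermitian V)]
  refine forall_congr' fun v => ?_
  rw [dotProduct_mulVec_self_eq_re (mul_swapMatrix_mul_isHermitian V), Complex.zero_le_real,
    star_dotProduct_mul_swapMatrix_mul, swapForm]

/-- The kernel of `V` and the range of `ΣV*` are `Σ`-orthogonal. A nonpositive kernel has dimension
at most `n`, hence exactly `n`, which gives the rank and a nonnegative range. Conversely, rank `n`
makes the range a maximal nonnegative subspace, and the argument runs with `s = -1`. -/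
theorem swapForm_nonpos_on_ker_iff : (∀ f, V *ᵥ f = 0 → swapForm f ≤ 0) ↔
    (V * swapMatrix n * Vᴴ).PosSemidef ∧ V.rank = n := by
  have hdim := finrank_ker_add_rank V
  rw [posSemidef_mul_swapMatrix_mul_iff]
  constructor
  · intro h
    have hN : ∀ f ∈ LinearMap.ker V.mulVecLin, 1 * swapForm f ≤ 0 := fun f hf => by
      rw [one_mul]; exact h f hf
    have h1 := finrank_le_of_swapForm_nonpos (one_mul 1) _ hN
    have h2 := V.rank_le_card_height
    rw [Fintype.card_fin] at h2
    refine ⟨fun v => ?_, by omega⟩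
    have h3 := swapForm_nonneg_of_orthogonal (one_mul 1) hN (by omega)
      (g := swapMatrix n *ᵥ (Vᴴ *ᵥ v)) fun f hf => by
        rw [swapMatrix_mulVec_swapMatrix_mulVec, star_dotProduct_conjTranspose_mulVec,
          show V *ᵥ f = 0 from hf, star_zero, zero_dotProduct]
    rwa [one_mul] at h3
  · rintro ⟨h, hr⟩ f hf
    let L := (swapMatrix n * Vᴴ).mulVecLin
    have hL : ∀ v, L v = swapMatrix n *ᵥ (Vᴴ *ᵥ v) := fun v => by
      simp [L, Matrix.mulVec_mulVec]
    have hrank : Module.finrank ℂ L.range = n := by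
      change (swapMatrix n * Vᴴ).rank = n
      rw [Matrix.rank_mul_eq_right_of_isUnit_det, Matrix.rank_conjTranspose, hr]
      exact (Matrix.isUnit_iff_isUnit_det _).mp
        (IsUnit.of_mul_eq_one _ swapMatrix_mul_self)
    have h3 := swapForm_nonneg_of_orthogonal (s := -1) (by norm_num) (N := L.range)
      (by
        rintro _ ⟨v, rfl⟩
        rw [hL]
        linarith [h v]) hrank (g := f) (by
        rintro _ ⟨v, rfl⟩
        rw [star_dotProduct_swapMatrix_mulVec_comm, hL, swapMatrix_mulVec_swapMatrix_mulVec,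
          star_dotProduct_conjTranspose_mulVec, hf, star_zero, zero_dotProduct, star_zero])
    linarith

end SwapForm

/-! ### From boundary values to the variables of the swap form -/

section BoundaryMatrix

variable {n : ℕ} {P₁ : Matrix (Fin n) (Fin n) ℂ}

theorem conjTranspose_mul_swapMatrix_mul (hP₁ : P₁.IsHermitian) :
    (Matrix.fromBlocks P₁ (-P₁) 1 1)ᴴ * swapMatrix n * Matrix.fromBlocks P₁ (-P₁) 1 1
      = Matrix.fromBlocks ((2 : ℂ) • P₁) 0 0 (-((2 : ℂ) • P₁)) := by
  rw [swapMatrix, Matrix.fromBlocks_conjTranspose, Matrix.fromBlocks_multiply,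
    Matrix.fromBlocks_multiply]
  simp [hP₁.eq, two_smul]

/-- Take determinants in the congruence with `diag(2P₁, -2P₁)`, which is invertible. -/
theorem isUnit_det_fromBlocks (hP₁ : P₁.IsHermitian) (hinv : IsUnit P₁) :
    IsUnit (Matrix.fromBlocks P₁ (-P₁) 1 1 : Matrix (Fin n ⊕ Fin n) (Fin n ⊕ Fin n) ℂ).det := by
  have h := congrArg Matrix.det (conjTranspose_mul_swapMatrix_mul hP₁)
  have hd : P₁.det ≠ 0 := ((Matrix.isUnit_iff_isUnit_det _).mp hinv).ne_zero
  rw [Matrix.det_mul, Matrix.det_fromBlocks_zero₂₁, Matrix.det_neg, Matrix.det_smul] at h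
  refine isUnit_iff_ne_zero.mpr fun h0 => ?_
  rw [h0, mul_zero] at h
  have : (2 : ℂ) ^ Fintype.card (Fin n) * P₁.det
      * ((-1) ^ Fintype.card (Fin n) * ((2 : ℂ) ^ Fintype.card (Fin n) * P₁.det)) ≠ 0 := by
    positivity
  exact this h.symm

theorem swapForm_fromBlocks_mulVec (hP₁ : P₁.IsHermitian) (u y : Fin n → ℂ) :
    swapForm (Matrix.fromBlocks P₁ (-P₁) 1 1 *ᵥ Sum.elim u y)
      = 2 * ((star u ⬝ᵥ (P₁ *ᵥ u)).re - (star y ⬝ᵥ (P₁ *ᵥ y)).re) := by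
  have hstar : star (Sum.elim u y) = Sum.elim (star u) (star y) := by
    ext i; cases i <;> simp
  rw [swapForm, Matrix.star_mulVec, ← Matrix.dotProduct_mulVec, Matrix.mulVec_mulVec,
    Matrix.mulVec_mulVec, conjTranspose_mul_swapMatrix_mul hP₁,
    Matrix.fromBlocks_mulVec, hstar, sumElim_dotProduct_sumElim]
  simp [Function.comp_def, Matrix.smul_mulVec, Matrix.neg_mulVec]
  ring

/-- The invertible matrix `[P₁, -P₁; I, I]` maps the kernel of `W` onto that of `W_B`, preserves the
rank, and doubles the boundary form into the swap form. -/
theorem boundary_form_nonpos_iff (hP₁ : P₁.IsHermitian) (hinv : IsUnit P₁)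
    (W : Matrix (Fin n) (Fin n ⊕ Fin n) ℂ) :
    (∀ u y : Fin n → ℂ, W *ᵥ Sum.elim u y = 0 →
      star u ⬝ᵥ (P₁ *ᵥ u) - star y ⬝ᵥ (P₁ *ᵥ y) ≤ 0) ↔
    (transformedBdryMatrix P₁ W * swapMatrix n * (transformedBdryMatrix P₁ W)ᴴ).PosSemidef ∧
      W.rank = n := by
  have hR := isUnit_det_fromBlocks hP₁ hinv
  have hWR : transformedBdryMatrix P₁ W * Matrix.fromBlocks P₁ (-P₁) 1 1 = W := by
    simp only [transformedBdryMatrix, cstarMatrix_hMul_eq]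
    rw [Matrix.mul_assoc, Matrix.nonsing_inv_mul _ hR, Matrix.mul_one]
  have hrank : W.rank = (transformedBdryMatrix P₁ W).rank := by
    conv_lhs => rw [← hWR]
    exact Matrix.rank_mul_eq_left_of_isUnit_det _ _ hR
  rw [cstarMatrix_hMul_eq] at hWR
  rw [hrank, ← swapForm_nonpos_on_ker_iff]
  constructor
  · intro h f hf
    set e := (Matrix.fromBlocks P₁ (-P₁) 1 1 : Matrix (Fin n ⊕ Fin n) (Fin n ⊕ Fin n) ℂ)⁻¹ *ᵥ f with he
    have hfe : f = (Matrix.fromBlocks P₁ (-P₁) 1 1 : Matrix (Fin n ⊕ Fin n) (Fin n ⊕ Fin n) ℂ) *ᵥ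
        Sum.elim (e ∘ Sum.inl) (e ∘ Sum.inr) := by
      rw [Sum.elim_comp_inl_inr, he, Matrix.mulVec_mulVec, Matrix.mul_nonsing_inv _ hR,
        Matrix.one_mulVec]
    rw [hfe, swapForm_fromBlocks_mulVec hP₁]
    have h1 := (dotProduct_sub_nonpos_iff hP₁ _ _).mp (h (e ∘ Sum.inl) (e ∘ Sum.inr) (by
      rw [← hWR, ← Matrix.mulVec_mulVec, ← hfe, hf]))
    linarith
  · intro h u y huy
    rw [dotProduct_sub_nonpos_iff hP₁]
    have h1 := h ((Matrix.fromBlocks P₁ (-P₁) 1 1 : Matrix (Fin n ⊕ Fin n) (Fin n ⊕ Fin n) ℂ)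
      *ᵥ Sum.elim u y) (by
      rw [Matrix.mulVec_mulVec, hWR, huy])
    rw [swapForm_fromBlocks_mulVec hP₁] at h1
    linarith

/-- Changing the sign of `P₁` multiplies the block matrix on the left by `J = diag(-1, 1)`, and
`JΣJ* = -Σ`. -/
theorem transformedBdryMatrix_neg (P₁ : Matrix (Fin n) (Fin n) ℂ)
    (W : Matrix (Fin n) (Fin n ⊕ Fin n) ℂ) :
    transformedBdryMatrix (-P₁) W * swapMatrix n * (transformedBdryMatrix (-P₁) W)ᴴ
      = -(transformedBdryMatrix P₁ W * swapMatrix n * (transformedBdryMatrix P₁ W)ᴴ) := by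
  let J : Matrix (Fin n ⊕ Fin n) (Fin n ⊕ Fin n) ℂ := Matrix.fromBlocks (-1) 0 0 1
  have hJJ : J * J = 1 := by
    simp [J, Matrix.fromBlocks_multiply, Matrix.fromBlocks_one]
  have hJR : (Matrix.fromBlocks (-P₁) (- -P₁) 1 1 : Matrix (Fin n ⊕ Fin n) (Fin n ⊕ Fin n) ℂ)
      = J * Matrix.fromBlocks P₁ (-P₁) 1 1 := by
    simp [J, Matrix.fromBlocks_multiply]
  have hJinv : J⁻¹ = J := Matrix.inv_eq_right_inv hJJ
  have hV : transformedBdryMatrix (-P₁) W = transformedBdryMatrix P₁ W * J := by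
    simp only [transformedBdryMatrix, cstarMatrix_hMul_eq]
    rw [hJR, Matrix.mul_inv_rev, hJinv, ← Matrix.mul_assoc]
  have hJS : J * swapMatrix n * Jᴴ = -swapMatrix n := by
    simp [J, swapMatrix, Matrix.fromBlocks_conjTranspose, Matrix.fromBlocks_multiply,
      Matrix.fromBlocks_neg]
  rw [hV, Matrix.conjTranspose_mul]
  calc transformedBdryMatrix P₁ W * J * swapMatrix n * (Jᴴ * (transformedBdryMatrix P₁ W)ᴴ)
      = transformedBdryMatrix P₁ W * (J * swapMatrix n * Jᴴ) * (transformedBdryMatrix P₁ W)ᴴ := by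
        simp only [Matrix.mul_assoc]
    _ = _ := by rw [hJS, Matrix.mul_neg, Matrix.neg_mul]

theorem eq_zero_iff_posSemidef_and_neg {M : Matrix (Fin n) (Fin n) ℂ} :
    M = 0 ↔ M.PosSemidef ∧ (-M).PosSemidef := by
  constructor
  · rintro rfl
    simpa using Matrix.PosSemidef.zero
  · rintro ⟨h1, h2⟩
    open scoped MatrixOrder in
    exact le_antisymm (by simpa [Matrix.le_iff] using h2) (by simpa [Matrix.le_iff] using h1)

end BoundaryMatrix

/-! ### The energy space -/

theorem toEuclideanCLM_apply_apply {n : ℕ} (M N : Matrix (Fin n) (Fin n) ℂ)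
    (v : EuclideanSpace ℂ (Fin n)) :
    Matrix.toEuclideanCLM (n := Fin n) (𝕜 := ℂ) M (Matrix.toEuclideanCLM (n := Fin n) (𝕜 := ℂ) N v)
      = Matrix.toEuclideanCLM (n := Fin n) (𝕜 := ℂ) (M * N) v := by
  rw [map_mul]; rfl

namespace HamiltonianDensity

variable {n : ℕ} (H : HamiltonianDensity n)

theorem isUnit_det : ∀ᵐ ζ ∂unitIntervalMeasure, IsUnit (H.toFun ζ).det := by
  filter_upwards [H.posDef] with ζ h
  exact (Matrix.isUnit_iff_isUnit_det _).mp h.isUnit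

/-- The Hamiltonian density `𝓗⁻¹`. -/
noncomputable def inv : HamiltonianDensity n where
  toFun ζ := (H.toFun ζ)⁻¹
  posDef := by
    filter_upwards [H.posDef] with ζ h using h.inv
  memLp_top := H.memLp_top_inv
  memLp_top_inv i j := by
    refine (memLp_congr_ae ?_).mp (H.memLp_top i j)
    filter_upwards [H.isUnit_det] with ζ h
    rw [Matrix.nonsing_inv_nonsing_inv _ h]

/-- An everywhere defined symmetric operator on a Hilbert space is bounded (Hellinger–Toeplitz), so
symmetry replaces an essential-supremum estimate. -/
theorem isSymmetric_mul : H.mul.IsSymmetric := fun x y => by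
  have h := inner_conj_symm (𝕜 := ℂ) ((EnergySpace.equiv H).symm x) ((EnergySpace.equiv H).symm y)
  rw [EnergySpace.inner_def, EnergySpace.inner_def, LinearEquiv.apply_symm_apply,
    LinearEquiv.apply_symm_apply, inner_conj_symm] at h
  exact h

/-- Multiplication by `𝓗` as a bounded operator. -/
noncomputable def mulCLM : StateSpace n →L[ℂ] StateSpace n :=
  ⟨H.mul, H.isSymmetric_mul.continuous⟩

theorem mulCLM_apply (x : StateSpace n) : H.mulCLM x = H.mul x := rfl

theorem mul_inv_mul (x : StateSpace n) : H.mul (H.inv.mul x) = x := by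
  ext1
  filter_upwards [H.coeFn_mul (H.inv.mul x), H.inv.coeFn_mul x, H.isUnit_det] with ζ h1 h2 h3
  rw [h1, h2, inv, toEuclideanCLM_apply_apply, Matrix.mul_nonsing_inv _ h3, map_one]
  rfl

end HamiltonianDensity

namespace EnergySpace

variable {n : ℕ} (H : HamiltonianDensity n)

theorem norm_sq_eq (x : EnergySpace H) :
    ‖x‖ ^ 2 = (inner ℂ (equiv H x) (H.mul (equiv H x))).re := by
  rw [← re_inner_self, inner_def]

theorem norm_sq_le (x : EnergySpace H) : ‖x‖ ^ 2 ≤ ‖H.mulCLM‖ * ‖equiv H x‖ ^ 2 := by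
  rw [norm_sq_eq]
  refine (Complex.re_le_norm _).trans ((norm_inner_le_norm _ _).trans ?_)
  have := mul_le_mul_of_nonneg_left (H.mulCLM.le_opNorm (equiv H x)) (norm_nonneg (equiv H x))
  rw [H.mulCLM_apply] at this
  linarith

/-- In the energy product, `‖y‖² = ⟨x, 𝓗⁻¹y⟩`; apply Cauchy–Schwarz there, and bound the energy of
`𝓗⁻¹y`, which is `⟨𝓗⁻¹y, y⟩`. No pointwise eigenvalue bound is needed. -/
theorem norm_sq_equiv_le (x : EnergySpace H) :
    ‖equiv H x‖ ^ 2 ≤ ‖H.inv.mulCLM‖ * ‖x‖ ^ 2 := by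
  set y := equiv H x with hy
  set k : EnergySpace H := (equiv H).symm (H.inv.mul y) with hk
  have hky : equiv H k = H.inv.mul y := LinearEquiv.apply_symm_apply _ _
  have h1 : ‖y‖ ^ 2 ≤ ‖x‖ * ‖k‖ := by
    have : (inner ℂ x k).re = ‖y‖ ^ 2 := by
      rw [inner_def, hky, H.mul_inv_mul, re_inner_self]
    rw [← this]
    exact (Complex.re_le_norm _).trans (norm_inner_le_norm _ _)
  have h2 : ‖k‖ ^ 2 ≤ ‖H.inv.mulCLM‖ * ‖y‖ ^ 2 := by
    rw [norm_sq_eq, hky, H.mul_inv_mul]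
    refine (Complex.re_le_norm _).trans ((norm_inner_le_norm _ _).trans ?_)
    have := mul_le_mul_of_nonneg_right (H.inv.mulCLM.le_opNorm y) (norm_nonneg y)
    rw [H.inv.mulCLM_apply] at this
    linarith
  rcases (sq_nonneg ‖y‖).eq_or_lt' with h0 | hpos
  · rw [h0]; positivity
  · refine le_of_mul_le_mul_right ?_ hpos
    calc ‖y‖ ^ 2 * ‖y‖ ^ 2 ≤ (‖x‖ * ‖k‖) * (‖x‖ * ‖k‖) := by gcongr
      _ = ‖x‖ ^ 2 * ‖k‖ ^ 2 := by ring
      _ ≤ ‖x‖ ^ 2 * (‖H.inv.mulCLM‖ * ‖y‖ ^ 2) := by gcongr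
      _ = _ := by ring

instance : CompleteSpace (EnergySpace H) := by
  have h1 : ∀ x, ‖equiv H x‖ ≤ √‖H.inv.mulCLM‖ * ‖x‖ := fun x => by
    rw [← Real.sqrt_sq (norm_nonneg x), ← Real.sqrt_mul (norm_nonneg _)]
    exact Real.le_sqrt_of_sq_le (norm_sq_equiv_le H x)
  have h2 : ∀ y, ‖(equiv H).symm y‖ ≤ √‖H.mulCLM‖ * ‖y‖ := fun y => by
    rw [← Real.sqrt_sq (norm_nonneg y), ← Real.sqrt_mul (norm_nonneg _)]
    refine Real.le_sqrt_of_sq_le ((norm_sq_le H _).trans_eq ?_)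
    rw [LinearEquiv.apply_symm_apply]
  let e := (equiv H).toContinuousLinearEquivOfBounds _ _ h1 h2
  exact (completeSpace_congr (e := e.toEquiv) e.isUniformEmbedding).mpr inferInstance

end EnergySpace

theorem HamiltonianDensity.exists_coercive {n : ℕ} (H : HamiltonianDensity n) :
    ∃ c > 0, ∀ x : StateSpace n, c * ‖x‖ ^ 2 ≤ (inner ℂ x (H.mul x)).re := by
  -- The summand `1` keeps the constant positive even when the operator norm is zero, as for `n =
  -- 0`.
  refine ⟨(‖H.inv.mulCLM‖ + 1)⁻¹, by positivity, fun x => ?_⟩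
  have h := EnergySpace.norm_sq_equiv_le H ((EnergySpace.equiv H).symm x)
  have h0 := EnergySpace.norm_sq_eq H ((EnergySpace.equiv H).symm x)
  rw [LinearEquiv.apply_symm_apply] at h h0
  rw [inv_mul_le_iff₀ (by positivity), ← h0]
  linarith [sq_nonneg ‖(EnergySpace.equiv H).symm x‖]

/-! ### Perturbation of the resolvent by a coercive operator -/

theorem norm_smul_sub_sq {E : Type*} [NormedAddCommGroup E] [InnerProductSpace ℂ E] (ν : ℝ)
    (x y : E) : ‖ν • x - y‖ ^ 2 = ν ^ 2 * ‖x‖ ^ 2 - 2 * ν * (inner ℂ x y).re + ‖y‖ ^ 2 := by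
  rw [← re_inner_self, inner_sub_left, inner_sub_right, inner_sub_right]
  simp only [Complex.sub_re, re_inner_real_smul_left, re_inner_real_smul_right, re_inner_self,
    re_inner_comm y x, norm_smul, mul_pow, Real.norm_eq_abs, sq_abs]
  ring

/-- Write `K - A = (ν - A) - (ν - K)`. For large `ν`, coercivity gives `‖ν - K‖ < ν`, while `(ν -
A)⁻¹` has norm at most `1/ν`; a Neumann series finishes. -/
theorem LinearPMap.exists_sub_eq_of_coercive {E : Type*} [NormedAddCommGroup E]
    [InnerProductSpace ℂ E] [CompleteSpace E] {A : E →ₗ.[ℂ] E}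
    (hdis : ∀ x : A.domain, (inner ℂ (A x) (x : E)).re ≤ 0)
    (hrange : ∀ μ : ℝ, 0 < μ → ∀ y, ∃ x : A.domain, (μ : ℂ) • (x : E) - A x = y)
    {K : E →L[ℂ] E} {c : ℝ} (hc : 0 < c) (hK : ∀ x, c * ‖x‖ ^ 2 ≤ (inner ℂ x (K x)).re) (f : E) :
    ∃ x : A.domain, K x - A x = f := by
  simp only [Complex.coe_smul] at hrange
  -- Chosen so that `ν² - 2νc + ‖K‖² ≤ ν² - 1`.
  set ν : ℝ := (‖K‖ ^ 2 + 1) / c with hν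
  have hνc : ν * c = ‖K‖ ^ 2 + 1 := div_mul_cancel₀ _ hc.ne'
  have hν0 : 0 < ν := by positivity
  obtain ⟨S, hS⟩ := A.exists_isResolventAt hν0.ne'
    (fun x => mul_nonpos_of_nonneg_of_nonpos hν0.le (hdis x)) (hrange ν hν0)
  let N : E →L[ℂ] E := ν • ContinuousLinearMap.id ℂ E - K
  have hN : ∀ x, N x = ν • x - K x := fun x => by simp [N]
  have hNle : ∀ x, ‖N x‖ ≤ √(ν ^ 2 - 1) * ‖x‖ := fun x => by
    rw [← Real.sqrt_sq (norm_nonneg x), ← Real.sqrt_mul' _ (sq_nonneg _)]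
    refine Real.le_sqrt_of_sq_le ?_
    rw [hN, norm_smul_sub_sq]
    have h1 : ‖K x‖ ^ 2 ≤ ‖K‖ ^ 2 * ‖x‖ ^ 2 := by
      rw [← mul_pow]
      exact pow_le_pow_left₀ (norm_nonneg _) (K.le_opNorm x) 2
    have h2 := mul_le_mul_of_nonneg_left (hK x) (by positivity : 0 ≤ 2 * ν)
    have h3 : 2 * ν * (c * ‖x‖ ^ 2) = 2 * (‖K‖ ^ 2 + 1) * ‖x‖ ^ 2 := by
      rw [← hνc]; ring
    nlinarith [sq_nonneg ‖x‖, mul_nonneg (sq_nonneg ‖K‖) (sq_nonneg ‖x‖)]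
  have hSN : ‖S * N‖ < 1 := by
    have hlt : √(ν ^ 2 - 1) < ν := (Real.sqrt_lt' hν0).mpr (by linarith)
    refine lt_of_le_of_lt ((S * N).opNorm_le_bound (M := √(ν ^ 2 - 1) / ν) (by positivity)
      fun x => ?_) ((div_lt_one hν0).mpr hlt)
    have h1 := (hS.norm_le (N x)).trans (hNle x)
    rw [abs_of_pos hν0] at h1
    rw [div_mul_eq_mul_div, le_div_iff₀ hν0]
    change ‖S (N x)‖ * ν ≤ _
    linarith
  obtain ⟨u, hu⟩ := isUnit_one_sub_of_norm_lt_one hSN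
  let z : E := (↑u⁻¹ : E →L[ℂ] E) (S f)
  have hz : z - S (N z) = S f := by
    have h1 : (1 - S * N) z = S f := by
      have h2 := congrArg (fun F : E →L[ℂ] E => F (S f)) u.mul_inv
      rw [hu] at h2
      exact h2
    exact h1
  obtain ⟨x, hx, hxy⟩ := hS.exists_eq (f + N z)
  have hxz : (x : E) = z := by
    rw [hx, _root_.map_add, ← hz, sub_add_cancel]
  refine ⟨x, ?_⟩
  rw [hN, ← hxz] at hxy
  have : K x - A x = (ν • (x : E) - A x) - (ν • (x : E) - K x) := by abel
  rw [this, hxy, add_sub_cancel_right]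

/-! ### Linear systems with constant coefficients -/

section LinearSystem

open NormedSpace

variable {n : ℕ}

theorem constMul_constMul (M N : Matrix (Fin n) (Fin n) ℂ) (x : StateSpace n) :
    constMul M (constMul N x) = constMul (M * N) x := by
  ext1
  filter_upwards [coeFn_constMul M (constMul N x), coeFn_constMul N x, coeFn_constMul (M * N) x]
    with ζ h1 h2 h3
  rw [h1, h2, h3, toEuclideanCLM_apply_apply]

theorem constMul_smul_one_sub (μ : ℝ) (M : Matrix (Fin n) (Fin n) ℂ) (x : StateSpace n) :
    constMul ((μ : ℂ) • 1 - M) x = (μ : ℂ) • x - constMul M x := by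
  ext1
  filter_upwards [coeFn_constMul ((μ : ℂ) • 1 - M) x, coeFn_constMul M x,
    Lp.coeFn_sub ((μ : ℂ) • x) (constMul M x), Lp.coeFn_smul (μ : ℂ) x] with ζ h1 h2 h3 h4
  rw [h1, h3, Pi.sub_apply, h4, Pi.smul_apply, h2, map_sub, map_smul, map_one]
  rfl

theorem hasDerivAt_exp_toEuclideanCLM (G : Matrix (Fin n) (Fin n) ℂ)
    (y : EuclideanSpace ℂ (Fin n)) (t : ℝ) :
    HasDerivAt (fun t : ℝ => exp (t • Matrix.toEuclideanCLM (n := Fin n) (𝕜 := ℂ) G) y)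
      (Matrix.toEuclideanCLM (n := Fin n) (𝕜 := ℂ) G
        (exp (t • Matrix.toEuclideanCLM (n := Fin n) (𝕜 := ℂ) G) y)) t :=
  hasDerivAt_exp_smul_apply _ y t

theorem continuous_exp_smul {E : Type*} [NormedAddCommGroup E] [InnerProductSpace ℂ E]
    [CompleteSpace E] (B : E →L[ℂ] E) : Continuous fun t : ℝ => exp (t • B) :=
  continuous_iff_continuousAt.mpr fun t => (hasDerivAt_exp_smul_const (𝕂 := ℝ) B t).continuousAt

theorem exp_zero_smul_apply {E : Type*} [NormedAddCommGroup E] [InnerProductSpace ℂ E]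
    (B : E →L[ℂ] E) (x : E) : exp ((0 : ℝ) • B) x = x := by
  simp

theorem exp_smul_apply_exp_neg_smul_apply {E : Type*} [NormedAddCommGroup E]
    [InnerProductSpace ℂ E] [CompleteSpace E] (B : E →L[ℂ] E) (t : ℝ) (x : E) :
    exp (t • B) (exp ((-t) • B) x) = x := by
  have h := congrArg (fun F : E →L[ℂ] E => F x) (exp_add_smul B t (-t))
  simpa using h.symm

/-- Variation of constants: the solution of `u' = G u + h`, `u(0) = y`. -/
theorem exists_isPrimitive_linear (G : Matrix (Fin n) (Fin n) ℂ) (h : StateSpace n) :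
    ∃ c : EuclideanSpace ℂ (Fin n), ∀ y, ∃ (u : ℝ → EuclideanSpace ℂ (Fin n)) (x : StateSpace n),
      IsPrimitive u (constMul G x + h : StateSpace n) ∧ x =ᵐ[unitIntervalMeasure] u ∧ u 0 = y ∧
      u 1 = exp (Matrix.toEuclideanCLM (n := Fin n) (𝕜 := ℂ) G) y + c := by
  set B := Matrix.toEuclideanCLM (n := Fin n) (𝕜 := ℂ) G with hB
  let ev := ContinuousLinearMap.restrictScalarsL ℂ (EuclideanSpace ℂ (Fin n))
    (EuclideanSpace ℂ (Fin n)) ℝ ℝ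
  have hneg : Continuous fun t : ℝ => exp ((-t) • B) :=
    (continuous_exp_smul B).comp continuous_neg
  have hint : IntervalIntegrable (fun t => exp ((-t) • B) (h t)) volume 0 1 :=
    h.intervalIntegrable.bilinear_continuousOn ev.flip hneg.continuousOn
  let w : ℝ → EuclideanSpace ℂ (Fin n) := fun t => ∫ s in (0 : ℝ)..t, exp ((-s) • B) (h s)
  -- This vector does not depend on `y`, so `u(1)` is an affine function of `u(0)`.
  refine ⟨exp B (w 1), fun y => ?_⟩
  have hw : IsPrimitive (fun t => y + w t) (fun t => exp ((-t) • B) (h t)) :=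
    ⟨hint, fun t _ => by simp [w]⟩
  have hE : IsPrimitive (fun t : ℝ => exp (t • B)) (fun t : ℝ => B * exp (t • B)) :=
    isPrimitive_of_hasDerivAt (fun t => hasDerivAt_exp_smul_const' (𝕂 := ℝ) B t)
      (continuous_const.mul (continuous_exp_smul B))
  have hu := hE.bilinear ev hw
  have hum := memLp_of_continuousOn_Icc hu.continuousOn
  refine ⟨_, hum.toLp, hu.congr_ae ?_, hum.coeFn_toLp, ?_, ?_⟩
  · filter_upwards [Lp.coeFn_add (constMul G hum.toLp) h, coeFn_constMul G hum.toLp,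
      hum.coeFn_toLp] with t h1 h2 h3
    rw [h1, Pi.add_apply, h2, h3]
    change exp (t • B) (exp ((-t) • B) (h t)) + B (exp (t • B) (y + w t)) = _
    rw [exp_smul_apply_exp_neg_smul_apply, add_comm]
    rfl
  · change exp ((0 : ℝ) • B) (y + w 0) = y
    rw [show w 0 = 0 from intervalIntegral.integral_same, add_zero]
    exact exp_zero_smul_apply B y
  · change exp ((1 : ℝ) • B) (y + w 1) = _
    rw [one_smul, map_add]

variable {P₁ P₀ : Matrix (Fin n) (Fin n) ℂ} {W : Matrix (Fin n) (Fin n ⊕ Fin n) ℂ}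

/-- Solved for `x'`, the equation `(μ - A)x = f` reads `x' = P₁⁻¹(μ - P₀)x - P₁⁻¹f`. -/
theorem constMul_inv_add_constMul (hinv : IsUnit P₁) (μ : ℝ) (x f : StateSpace n) :
    (μ : ℂ) • x - (constMul P₁ (constMul (P₁⁻¹ * ((μ : ℂ) • 1 - P₀)) x + constMul (-P₁⁻¹) f)
      + constMul P₀ x) = f := by
  have hd := (Matrix.isUnit_iff_isUnit_det _).mp hinv
  have h1 : constMul (-1 : Matrix (Fin n) (Fin n) ℂ) f = -f := by
    ext1
    filter_upwards [coeFn_constMul (-1) f, Lp.coeFn_neg f] with ζ h1 h2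
    rw [h1, h2, map_neg, map_one]
    rfl
  rw [map_add, constMul_constMul, constMul_constMul, ← Matrix.mul_assoc,
    Matrix.mul_nonsing_inv _ hd, Matrix.one_mul, Matrix.mul_neg, Matrix.mul_nonsing_inv _ hd,
    constMul_smul_one_sub, h1]
  abel

/-- The boundary condition becomes `Φ y = -W[c; 0]` for the initial value `y`. A kernel vector of
`Φ` would give a solution of `Ax = μx`, which dissipativity forces to be zero; as `Φ` acts between
spaces of dimension `n`, it is onto. -/
theorem portOperator_exists_smul_sub_eq (hinv : IsUnit P₁)
    (hdis : ∀ x : (portOperator P₁ P₀ W).domain,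
      (inner ℂ (portOperator P₁ P₀ W x) (x : StateSpace n)).re ≤ 0) (μ : ℝ) (hμ : 0 < μ)
    (f : StateSpace n) :
    ∃ x : (portOperator P₁ P₀ W).domain, (μ : ℂ) • (x : StateSpace n) - portOperator P₁ P₀ W x = f := by
  set G := P₁⁻¹ * ((μ : ℂ) • 1 - P₀) with hG
  set F := exp (Matrix.toEuclideanCLM (n := Fin n) (𝕜 := ℂ) G) with hF
  let Φ : EuclideanSpace ℂ (Fin n) →ₗ[ℂ] (Fin n → ℂ) :=
    { toFun := fun y => W *ᵥ Sum.elim (F y).ofLp y.ofLp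
      map_add' := fun y z => by
        rw [← Matrix.mulVec_add]
        congr 1
        ext i; cases i <;> simp
      map_smul' := fun c y => by
        rw [← Matrix.mulVec_smul]
        congr 1
        ext i; cases i <;> simp }
  have hinj : Function.Injective Φ := by
    rw [← LinearMap.ker_eq_bot, LinearMap.ker_eq_bot']
    intro y hy
    have hu := hasDerivAt_exp_toEuclideanCLM G y
    have huc : Continuous fun t : ℝ =>
        exp (t • Matrix.toEuclideanCLM (n := Fin n) (𝕜 := ℂ) G) y :=
      continuous_iff_continuousAt.mpr fun t => (hu t).continuousAt
    have hum := memLp_of_continuousOn_Icc huc.continuousOn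
    -- The zero inhomogeneity is kept in the formula so that `constMul_inv_add_constMul` applies
    -- with `f = 0`.
    have hprim := (isPrimitive_of_hasDerivAt hu
      ((ContinuousLinearMap.continuous _).comp huc)).congr_ae
      (g' := (constMul G hum.toLp + constMul (-P₁⁻¹) 0 : StateSpace n)) (by
        rw [map_zero, add_zero]
        filter_upwards [coeFn_constMul G hum.toLp, hum.coeFn_toLp] with t h1 h2
        rw [h1, h2])
    obtain ⟨z, hz, hAz⟩ := portOperator_exists_of_isPrimitive P₁ P₀ W hprim hum.coeFn_toLp (by
      rw [one_smul]
      refine Eq.trans ?_ hy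
      exact congrArg (fun v : EuclideanSpace ℂ (Fin n) => W *ᵥ Sum.elim (F y).ofLp v.ofLp)
        (exp_zero_smul_apply _ y))
    have h1 := (portOperator P₁ P₀ W).abs_mul_norm_le_norm_coe_smul_sub
      (fun x => mul_nonpos_of_nonneg_of_nonpos hμ.le (hdis x)) z
    rw [hAz, hz, constMul_inv_add_constMul hinv, norm_zero, abs_of_pos hμ] at h1
    have h2 : hum.toLp = 0 := by
      rw [← norm_le_zero_iff]
      exact nonpos_of_mul_nonpos_right h1 hμ
    have h3 := eqOn_Icc_of_ae_eq_unitInterval huc.continuousOn (continuousOn_const (c := 0))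
      (hum.coeFn_toLp.symm.trans ((Lp.eq_zero_iff_ae_eq_zero).mp h2))
      (left_mem_Icc.mpr zero_le_one)
    exact (exp_zero_smul_apply _ y).symm.trans h3
  have hsurj : Function.Surjective Φ :=
    (LinearMap.injective_iff_surjective_of_finrank_eq_finrank (by simp)).mp hinj
  obtain ⟨c, hc⟩ := exists_isPrimitive_linear G (constMul (-P₁⁻¹) f)
  obtain ⟨y, hy⟩ := hsurj (-(W *ᵥ Sum.elim c.ofLp 0))
  obtain ⟨u, x, hux, hxu, hu0, hu1⟩ := hc y
  obtain ⟨z, hz, hAz⟩ := portOperator_exists_of_isPrimitive P₁ P₀ W hux hxu (by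
    rw [hu0, hu1]
    have : Sum.elim (F y + c).ofLp y.ofLp = Sum.elim (F y).ofLp y.ofLp + Sum.elim c.ofLp 0 := by
      ext i; cases i <;> simp
    rw [this, Matrix.mulVec_add]
    change Φ y + _ = 0
    rw [hy, neg_add_cancel])
  exact ⟨z, by rw [hAz, hz, constMul_inv_add_constMul hinv]⟩

end LinearSystem

/-! ### The operator `A𝓗` -/

section CompHamiltonian

variable {n : ℕ} {A : StateSpace n →ₗ.[ℂ] StateSpace n} (H : HamiltonianDensity n)

theorem mem_domain_compHamiltonian {x : EnergySpace H} :
    x ∈ (compHamiltonian A H).domain ↔ H.mul (EnergySpace.equiv H x) ∈ A.domain := Iff.rfl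

theorem compHamiltonian_apply_of_eq {x : (compHamiltonian A H).domain} {z : A.domain}
    (h : H.mul (EnergySpace.equiv H (x : EnergySpace H)) = z) :
    compHamiltonian A H x = (EnergySpace.equiv H).symm (A z) := by
  obtain ⟨z, hz⟩ := z
  subst h
  rfl

theorem exists_compHamiltonian_eq (z : A.domain) :
    ∃ x : (compHamiltonian A H).domain,
      (x : EnergySpace H) = (EnergySpace.equiv H).symm (H.inv.mul z) ∧
      compHamiltonian A H x = (EnergySpace.equiv H).symm (A z) := by
  have hz : H.mul (EnergySpace.equiv H ((EnergySpace.equiv H).symm (H.inv.mul z))) = z := by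
    rw [LinearEquiv.apply_symm_apply, H.mul_inv_mul]
  have hmem : (EnergySpace.equiv H).symm (H.inv.mul z) ∈ (compHamiltonian A H).domain := by
    rw [mem_domain_compHamiltonian, hz]
    exact z.2
  exact ⟨⟨_, hmem⟩, rfl, compHamiltonian_apply_of_eq H hz⟩

theorem inner_compHamiltonian (x : (compHamiltonian A H).domain) :
    ∃ z : A.domain, inner ℂ (compHamiltonian A H x) (x : EnergySpace H)
      = inner ℂ (A z) (z : StateSpace n) :=
  ⟨⟨H.mul (EnergySpace.equiv H x), x.2⟩, rfl⟩

/-- `𝓗` is invertible, so `z = 𝓗x` exhausts `D(A)`. The predicate `p` serves both `≤ 0` and `= 0`.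
-/
theorem forall_re_inner_compHamiltonian_iff (p : ℝ → Prop) :
    (∀ x : (compHamiltonian A H).domain,
      p (inner ℂ (compHamiltonian A H x) (x : EnergySpace H)).re) ↔
    ∀ z : A.domain, p (inner ℂ (A z) (z : StateSpace n)).re := by
  constructor
  · intro h z
    obtain ⟨x, hx, hAx⟩ := exists_compHamiltonian_eq H z
    have h1 := h x
    rwa [EnergySpace.inner_def, hx, hAx, LinearEquiv.apply_symm_apply,
      LinearEquiv.apply_symm_apply, H.mul_inv_mul] at h1
  · intro h x
    obtain ⟨z, hz⟩ := inner_compHamiltonian H x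
    rw [hz]
    exact h z

/-- With `z = 𝓗x` the equation is `μ𝓗⁻¹z - Az = y`, and `μ𝓗⁻¹` is coercive. -/
theorem compHamiltonian_exists_smul_sub_eq
    (hdis : ∀ x : A.domain, (inner ℂ (A x) (x : StateSpace n)).re ≤ 0)
    (hrange : ∀ μ : ℝ, 0 < μ → ∀ y, ∃ x : A.domain, (μ : ℂ) • (x : StateSpace n) - A x = y)
    (μ : ℝ) (hμ : 0 < μ) (y : EnergySpace H) :
    ∃ x : (compHamiltonian A H).domain, μ • (x : EnergySpace H) - compHamiltonian A H x = y := by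
  obtain ⟨c, hc, hcK⟩ := H.inv.exists_coercive
  obtain ⟨z, hz⟩ := A.exists_sub_eq_of_coercive hdis hrange (K := (μ : ℂ) • H.inv.mulCLM)
    (c := μ * c) (mul_pos hμ hc) (fun x => by
      rw [smul_apply, inner_smul_right, Complex.re_ofReal_mul, mul_assoc]
      exact mul_le_mul_of_nonneg_left (hcK x) hμ.le) (EnergySpace.equiv H y)
  obtain ⟨x, hx, hAx⟩ := exists_compHamiltonian_eq H z
  refine ⟨x, ?_⟩
  rw [hx, hAx, ← Complex.coe_smul, ← map_smul, ← map_sub, LinearEquiv.symm_apply_eq]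
  exact hz

theorem compHamiltonian_neg_apply {B : StateSpace n →ₗ.[ℂ] StateSpace n}
    (hBA : ∀ z : B.domain, ∃ w : A.domain, (w : StateSpace n) = z ∧ B z = -A w)
    (x : (compHamiltonian B H).domain) :
    ∃ w : (compHamiltonian A H).domain, (w : EnergySpace H) = x ∧
      compHamiltonian B H x = -compHamiltonian A H w := by
  obtain ⟨z, hz⟩ : ∃ z : B.domain, H.mul (EnergySpace.equiv H (x : EnergySpace H)) = z :=
    ⟨⟨_, x.2⟩, rfl⟩
  obtain ⟨w, hwz, hBw⟩ := hBA z
  have hx : (x : EnergySpace H) ∈ (compHamiltonian A H).domain := by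
    rw [mem_domain_compHamiltonian, hz, ← hwz]
    exact w.2
  refine ⟨⟨x, hx⟩, rfl, ?_⟩
  rw [compHamiltonian_apply_of_eq H hz, hBw, map_neg,
    compHamiltonian_apply_of_eq H (x := ⟨x, hx⟩) (z := w) (hz.trans hwz.symm)]

end CompHamiltonian

/-! ### Sign reversal and the equivalences -/

section Main

variable {n : ℕ} {P₁ P₀ : Matrix (Fin n) (Fin n) ℂ} {W : Matrix (Fin n) (Fin n ⊕ Fin n) ℂ}

theorem constMul_neg (M : Matrix (Fin n) (Fin n) ℂ) (x : StateSpace n) :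
    constMul (-M) x = -constMul M x := by
  ext1
  filter_upwards [coeFn_constMul (-M) x, coeFn_constMul M x, Lp.coeFn_neg (constMul M x)]
    with ζ h1 h2 h3
  rw [h1, h3, Pi.neg_apply, h2, map_neg]
  rfl

theorem portOperator_neg_apply (x : StateSpace n) (hx : x ∈ (portOperator P₁ P₀ W).domain) :
    portOperator (-P₁) (-P₀) W ⟨x, hx⟩ = -portOperator P₁ P₀ W ⟨x, hx⟩ := by
  change constMul (-P₁) (weakDeriv n ⟨x, hx.1⟩) + constMul (-P₀) x
    = -(constMul P₁ (weakDeriv n ⟨x, hx.1⟩) + constMul P₀ x)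
  rw [constMul_neg, constMul_neg, neg_add]

theorem re_inner_portOperator_neg (x : StateSpace n) (hx : x ∈ (portOperator P₁ P₀ W).domain) :
    (inner ℂ (portOperator (-P₁) (-P₀) W ⟨x, hx⟩) x).re
      = -(inner ℂ (portOperator P₁ P₀ W ⟨x, hx⟩) x).re := by
  rw [portOperator_neg_apply, inner_neg_left, Complex.neg_re]

theorem hermitianPart_neg (M : Matrix (Fin n) (Fin n) ℂ) :
    hermitianPart (-M) = -hermitianPart M := by
  rw [hermitianPart, hermitianPart, Matrix.conjTranspose_neg, ← neg_add, smul_neg]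

theorem portOperator_dissipative_iff (hP₁ : P₁.IsHermitian) :
    (∀ x : (portOperator P₁ P₀ W).domain,
      (inner ℂ (portOperator P₁ P₀ W x) (x : StateSpace n)).re ≤ 0) ↔
    (-hermitianPart P₀).PosSemidef ∧ ∀ u y : Fin n → ℂ, W *ᵥ Sum.elim u y = 0 →
      star u ⬝ᵥ (P₁ *ᵥ u) - star y ⬝ᵥ (P₁ *ᵥ y) ≤ 0 :=
  ⟨fun h => ⟨posSemidef_neg_hermitianPart_of_dissipative hP₁ h,
    boundary_form_nonpos_of_dissipative hP₁ h⟩, fun h => portOperator_dissipative hP₁ h.1 h.2⟩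

/-- Negating both matrices negates the operator and leaves its domain unchanged. -/
theorem portOperator_skew_iff_dissipative :
    (∀ x : (portOperator P₁ P₀ W).domain,
      (inner ℂ (portOperator P₁ P₀ W x) (x : StateSpace n)).re = 0) ↔
    (∀ x : (portOperator P₁ P₀ W).domain,
      (inner ℂ (portOperator P₁ P₀ W x) (x : StateSpace n)).re ≤ 0) ∧
    (∀ x : (portOperator (-P₁) (-P₀) W).domain,
      (inner ℂ (portOperator (-P₁) (-P₀) W x) (x : StateSpace n)).re ≤ 0) := by
  constructor
  · exact fun h => ⟨fun x => (h x).le, fun x => by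
      have h1 := re_inner_portOperator_neg (P₁ := P₁) (P₀ := P₀) x.1 x.2
      rw [h ⟨x.1, x.2⟩, neg_zero] at h1
      exact h1.le⟩
  · rintro ⟨h1, h2⟩ x
    refine le_antisymm (h1 x) ?_
    have h := h2 ⟨x.1, x.2⟩
    rw [re_inner_portOperator_neg x.1 x.2] at h
    linarith

theorem portOperator_skew_iff (hP₁ : P₁.IsHermitian) :
    (∀ x : (portOperator P₁ P₀ W).domain,
      (inner ℂ (portOperator P₁ P₀ W x) (x : StateSpace n)).re = 0) ↔
    hermitianPart P₀ = 0 ∧ ∀ u y : Fin n → ℂ, W *ᵥ Sum.elim u y = 0 →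
      star u ⬝ᵥ (P₁ *ᵥ u) - star y ⬝ᵥ (P₁ *ᵥ y) = 0 := by
  rw [portOperator_skew_iff_dissipative, portOperator_dissipative_iff hP₁,
    portOperator_dissipative_iff hP₁.neg, hermitianPart_neg, neg_neg,
    eq_zero_iff_posSemidef_and_neg]
  have hneg : ∀ u y : Fin n → ℂ, star u ⬝ᵥ (-P₁ *ᵥ u) - star y ⬝ᵥ (-P₁ *ᵥ y)
      = -(star u ⬝ᵥ (P₁ *ᵥ u) - star y ⬝ᵥ (P₁ *ᵥ y)) := fun u y => by
    rw [Matrix.neg_mulVec, Matrix.neg_mulVec, dotProduct_neg, dotProduct_neg]; ring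
  simp only [hneg, neg_nonpos]
  constructor
  · rintro ⟨⟨h1, h2⟩, h3, h4⟩
    exact ⟨⟨h3, h1⟩, fun u y h => le_antisymm (h2 u y h) (h4 u y h)⟩
  · rintro ⟨⟨h3, h1⟩, h2⟩
    exact ⟨⟨h1, fun u y h => (h2 u y h).le⟩, h3, fun u y h => (h2 u y h).ge⟩

theorem boundary_form_eq_zero_iff (hP₁ : P₁.IsHermitian) (hinv : IsUnit P₁)
    (W : Matrix (Fin n) (Fin n ⊕ Fin n) ℂ) :
    (∀ u y : Fin n → ℂ, W *ᵥ Sum.elim u y = 0 →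
      star u ⬝ᵥ (P₁ *ᵥ u) - star y ⬝ᵥ (P₁ *ᵥ y) = 0) ↔
    transformedBdryMatrix P₁ W * swapMatrix n * (transformedBdryMatrix P₁ W)ᴴ = 0 ∧
      W.rank = n := by
  have h1 := boundary_form_nonpos_iff hP₁ hinv W
  have h2 := boundary_form_nonpos_iff hP₁.neg hinv.neg W
  rw [transformedBdryMatrix_neg] at h2
  have hneg : ∀ u y : Fin n → ℂ, star u ⬝ᵥ (-P₁ *ᵥ u) - star y ⬝ᵥ (-P₁ *ᵥ y)
      = -(star u ⬝ᵥ (P₁ *ᵥ u) - star y ⬝ᵥ (P₁ *ᵥ y)) := fun u y => by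
    rw [Matrix.neg_mulVec, Matrix.neg_mulVec, dotProduct_neg, dotProduct_neg]; ring
  simp only [hneg, neg_nonpos] at h2
  rw [eq_zero_iff_posSemidef_and_neg]
  constructor
  · intro h
    have h3 := h1.mp fun u y huy => (h u y huy).le
    have h4 := h2.mp fun u y huy => (h u y huy).ge
    exact ⟨⟨h3.1, h4.1⟩, h3.2⟩
  · rintro ⟨⟨h3, h4⟩, h5⟩ u y huy
    exact le_antisymm (h1.mpr ⟨h3, h5⟩ u y huy) (h2.mpr ⟨h4, h5⟩ u y huy)

theorem generatesContractionSemigroup_compHamiltonian_iff (hinv : IsUnit P₁)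
    (H : HamiltonianDensity n) :
    GeneratesContractionSemigroup (compHamiltonian (portOperator P₁ P₀ W) H) ↔
    ∀ x : (portOperator P₁ P₀ W).domain,
      (inner ℂ (portOperator P₁ P₀ W x) (x : StateSpace n)).re ≤ 0 := by
  rw [← forall_re_inner_compHamiltonian_iff H (· ≤ 0)]
  refine ⟨fun h => h.re_inner_nonpos, fun h => ?_⟩
  have hdis := (forall_re_inner_compHamiltonian_iff H (· ≤ 0)).mp h
  exact generatesContractionSemigroup_of_dissipative h
    (compHamiltonian_exists_smul_sub_eq H hdis (portOperator_exists_smul_sub_eq hinv hdis))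

theorem generatesUnitaryGroup_compHamiltonian_iff (hinv : IsUnit P₁)
    (H : HamiltonianDensity n) :
    GeneratesUnitaryGroup (compHamiltonian (portOperator P₁ P₀ W) H) ↔
    ∀ x : (portOperator P₁ P₀ W).domain,
      (inner ℂ (portOperator P₁ P₀ W x) (x : StateSpace n)).re = 0 := by
  rw [← forall_re_inner_compHamiltonian_iff H (· = 0)]
  refine ⟨fun h => h.re_inner_eq_zero, fun h => ?_⟩
  obtain ⟨hdis, hdis'⟩ := portOperator_skew_iff_dissipative.mp
    ((forall_re_inner_compHamiltonian_iff H (· = 0)).mp h)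
  refine generatesUnitaryGroup_of_skew h fun μ hμ y => ?_
  rcases hμ.lt_or_gt with hneg | hpos
  -- For `μ < 0`, solve `(-μ)x - (-A)𝓗x = -y` with the dissipative operator `-A` and change signs.
  · obtain ⟨x, hx⟩ := compHamiltonian_exists_smul_sub_eq H hdis'
      (portOperator_exists_smul_sub_eq hinv.neg hdis') (-μ) (neg_pos.mpr hneg) (-y)
    obtain ⟨w, hwx, hw⟩ := compHamiltonian_neg_apply H (A := portOperator P₁ P₀ W)
      (B := portOperator (-P₁) (-P₀) W)
      (fun z => ⟨⟨z.1, z.2⟩, rfl, portOperator_neg_apply (P₁ := P₁) (P₀ := P₀) z.1 z.2⟩) x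
    refine ⟨w, ?_⟩
    rw [hw, ← hwx, neg_smul, ← neg_sub', neg_inj] at hx
    exact hx
  · exact compHamiltonian_exists_smul_sub_eq H hdis (portOperator_exists_smul_sub_eq hinv hdis)
      μ hpos y

end Main

theorem theorem1p1 {n : ℕ} (P₁ P₀ : Matrix (Fin n) (Fin n) ℂ)
    (hP₁ : P₁.IsHermitian) (hP₁_inv : IsUnit P₁)
    (H : HamiltonianDensity n) (W : Matrix (Fin n) (Fin n ⊕ Fin n) ℂ) :
    [ GeneratesContractionSemigroup (compHamiltonian (portOperator P₁ P₀ W) H),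
      ∀ x : (portOperator P₁ P₀ W).domain,
        (inner ℂ (portOperator P₁ P₀ W x) (x : StateSpace n)).re ≤ 0,
      (-hermitianPart P₀).PosSemidef ∧
        ∀ u y : Fin n → ℂ, W *ᵥ Sum.elim u y = 0 →
          star u ⬝ᵥ (P₁ *ᵥ u) - star y ⬝ᵥ (P₁ *ᵥ y) ≤ 0,
      (-hermitianPart P₀).PosSemidef ∧
        (transformedBdryMatrix P₁ W * swapMatrix n * (transformedBdryMatrix P₁ W)ᴴ).PosSemidef ∧
        W.rank = n ].TFAE ∧
    [ GeneratesUnitaryGroup (compHamiltonian (portOperator P₁ P₀ W) H),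
      ∀ x : (portOperator P₁ P₀ W).domain,
        (inner ℂ (portOperator P₁ P₀ W x) (x : StateSpace n)).re = 0,
      hermitianPart P₀ = 0 ∧
        ∀ u y : Fin n → ℂ, W *ᵥ Sum.elim u y = 0 →
          star u ⬝ᵥ (P₁ *ᵥ u) - star y ⬝ᵥ (P₁ *ᵥ y) = 0,
      hermitianPart P₀ = 0 ∧
        transformedBdryMatrix P₁ W * swapMatrix n * (transformedBdryMatrix P₁ W)ᴴ = 0 ∧
        W.rank = n ].TFAE := by
  refine ⟨?_, ?_⟩
  · tfae_have 1 ↔ 2 := generatesContractionSemigroup_compHamiltonian_iff hP₁_inv H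
    tfae_have 2 ↔ 3 := portOperator_dissipative_iff hP₁
    tfae_have 3 ↔ 4 := and_congr_right fun _ => boundary_form_nonpos_iff hP₁ hP₁_inv W
    tfae_finish
  · tfae_have 1 ↔ 2 := generatesUnitaryGroup_compHamiltonian_iff hP₁_inv H
    tfae_have 2 ↔ 3 := portOperator_skew_iff hP₁
    tfae_have 3 ↔ 4 := and_congr_right fun _ => boundary_form_eq_zero_iff hP₁ hP₁_inv W
    tfae_finish
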